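/- All languages are subsets of $\{0,1\}^*$; $L_n$ denotes the set of strings of length $n$ in $L$. A set $S$ of positive integers is \emph{robust} if for each positive integer $k$ there is an integer $m\ge 2$ such that $n\in S$ for all $m\le n\le m^k$. For a language $L$ and a complexity class $\mathcal C$, write $L\in\mathrm{ro}\,\mathcal C$ ($L$ is \emph{robustly often} in $\mathcal C$) if there are a robust set $S$ and a language $L'\in\mathcal C$ with $L_n=L'_n$ for all $n\in S$; and $\mathcal B\subseteq\mathrm{ro}\,\mathcal C$ if $L\in\mathrm{ro}\,\mathcal C$ for every $L\in\mathcal B$. Let $\mathrm{PH}=\bigcup_k\Sigma_k^p$ denote the polynomial hierarchy. \textbf{Theorem.} If $\mathrm{NP}\subseteq\mathrm{ro}\,\mathrm{P}$, then $\mathrm{PH}\subseteq\mathrm{ro}\,\mathrm{P}$. -/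

import Mathlib

/-! Languages over `{0, 1}` are Mathlib's `Language Bool`; a complexity class is a set of
languages; deterministic polynomial time is Mathlib's `Turing.TM2ComputableInPolyTime`, that is,
polynomial time on deterministic machines with finitely many stacks and finite control. -/

namespace RobustlyOften

/-- The class `P`: languages whose characteristic function is computed by a deterministic machine
in time polynomial in the length of the input string. -/
def classP : Set (Language Bool) :=
  {L | ∃ f : List Bool → Bool,
    Nonempty (Turing.TM2ComputableInPolyTime (id : List Bool → List Bool)
      Computability.encodeBool f) ∧
    ∀ x, x ∈ L ↔ f x = true}

/-- The standard encoding of a pair of strings as one string: every bit of `x` is doubled, then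
comes the separator `01`, then `y`. -/
def pair (x y : List Bool) : List Bool :=
  x.flatMap (fun b => [b, b]) ++ [false, true] ++ y

/-- The encoding of pairs is injective. -/
theorem pair_injective {x y x' y' : List Bool} (h : pair x y = pair x' y') : x = x' ∧ y = y' := by
  induction x generalizing x' with
  | nil =>
    cases x' with
    | nil => simpa [pair] using h
    | cons b t => cases b <;> simp [pair] at h
  | cons a s ih =>
    cases x' with
    | nil => cases a <;> simp [pair] at h
    | cons b t =>
      have h2 : a = b ∧ pair s y = pair t y' := by
        simpa [pair] using h
      obtain ⟨h3, h4⟩ := ih h2.2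
      exact ⟨by rw [h2.1, h3], h4⟩

/-- Polynomially bounded existential quantification: the languages of the form
`{x | ∃ y, |y| ≤ p(|x|) ∧ ⟨x, y⟩ ∈ V}` with `V ∈ C` and `p` a polynomial. -/
def polyExists (C : Set (Language Bool)) : Set (Language Bool) :=
  {L | ∃ V ∈ C, ∃ p : Polynomial ℕ,
    ∀ x, x ∈ L ↔ ∃ y : List Bool, y.length ≤ p.eval x.length ∧ pair x y ∈ V}

/-- The class `co C` of complements of the languages in `C`. -/
def co (C : Set (Language Bool)) : Set (Language Bool) :=
  {L | Lᶜ ∈ C}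

/-- The class `NP`: languages with polynomially long certificates that are verified in
deterministic polynomial time. -/
def classNP : Set (Language Bool) :=
  polyExists classP

/-- The level `Σₖᵖ` of the polynomial hierarchy: `k` alternating polynomially bounded quantifiers,
the first one existential, in front of a polynomial-time predicate. -/
def sigmaP : ℕ → Set (Language Bool)
  | 0 => classP
  | k + 1 => polyExists (co (sigmaP k))

/-- The polynomial hierarchy `PH`, the union of the classes `Σₖᵖ`. -/
def classPH : Set (Language Bool) :=
  ⋃ k, sigmaP k

/-- `Lₙ`, the strings of length `n` in `L`. -/
def slice (L : Language Bool) (n : ℕ) : Set (List Bool) :=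
  {x | x ∈ L ∧ x.length = n}

/-- A set `S` of positive integers is robust if for each positive integer `k` there is `m ≥ 2`
with `n ∈ S` for all `m ≤ n ≤ m ^ k`. -/
def IsRobust (S : Set ℕ) : Prop :=
  (∀ n ∈ S, 0 < n) ∧
    ∀ k : ℕ, 0 < k → ∃ m : ℕ, 2 ≤ m ∧ ∀ n : ℕ, m ≤ n → n ≤ m ^ k → n ∈ S

/-- `L ∈ C` on `S`. -/
def InOn (L : Language Bool) (C : Set (Language Bool)) (S : Set ℕ) : Prop :=
  ∃ L' ∈ C, ∀ n ∈ S, slice L n = slice L' n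

/-- The class `ro C` of languages that are robustly often in `C`. -/
def ro (C : Set (Language Bool)) : Set (Language Bool) :=
  {L | ∃ S : Set ℕ, IsRobust S ∧ InOn L C S}

end RobustlyOften

/-! Robust sets are not closed under intersection, so a fresh application of the hypothesis at each
level of the hierarchy would give good lengths that need not be compatible. Instead the hypothesis
is applied once, to a single NP-complete language `clauseSat`, giving one robust set `S`. All later
loss is a shrinking of `S` to `stretch S c`, the lengths `n` whose whole window from `n` to `n ^ c`
lies in `S`; this is again robust, because windows may be chosen with a larger exponent
(`IsRobust.stretch`).

By induction on `k`, every `L` in `sigmaP k` is in P on some `stretch S c`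
(`inOn_stretch_of_mem_sigmaP`). Let `x ∈ L` mean that some short `y` has `pair x y ∈ V`, with `Vᶜ`
one level lower. By induction a polynomial-time `f` decides `Vᶜ` on suitable lengths. If a large
enough window above `|x|` lies in `S`, then `f` is right on every relevant pair, so `x ∈ L` iff some
short `y` has `f (pair x y) = false`. This is an honest NP question about the machine for `f`. It
reduces to `F x ∈ clauseSat` with `|x| ≤ |F x| ≤ |x| ^ e`, so `|F x|` is in `S` and the
polynomial-time decider for `clauseSat` on `S` answers it. Both length bounds matter: the reduction
must not leave the window on either side.

Most of the work is the NP-completeness of `clauseSat` for `TM2` machines. A run is laid out as a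
sequence of cells, row after row; a row holds a state followed by the levels of all stacks. With
rows of `g + 3` cells, each new cell is a fixed function of three neighbouring cells in the previous
row and of the cell just written, so the sequence is the run of a shift register
(`register_eq_timeRow`). The action of a step is copied along the row, so every level knows whether
to move up or down. The clauses for one register step are a fixed finite list translated along the
string (`register_sat_iff`), which makes the formula easy to write down: its program needs only
unary counters and loops (`progComputable_machineFormula`). Such stack programs compile to `TM2`
machines and can be prefixed to any given one (`ProgComputable.compose`), which turns the reduction
into membership in P. -/

/-! ### Stack programs and their compilation to `TM2` machines -/

namespace RobustlyOften

open Turing Function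

/-- Structured programs over finitely many registers, each of which holds a stack of bits. -/
inductive Cmd (R : Type)
  | skip
  | push (r : R) (b : Bool)
  | seq (c d : Cmd R)
  | casePop (r : R) (k : Option Bool → Cmd R)
  | loop (r : R) (k : Bool → Cmd R)

/-- Contents of the registers. -/
abbrev Store (R : Type) := R → List Bool

/-- `Run c s s' n`: started in `s`, the program `c` stops in `s'` after `n` steps. -/
inductive Run {R : Type} [DecidableEq R] : Cmd R → Store R → Store R → ℕ → Prop
  | skip (s) : Run .skip s s 1
  | push (r b s) : Run (.push r b) s (update s r (b :: s r)) 1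
  | seq {c d s s₁ s₂ m n} : Run c s s₁ m → Run d s₁ s₂ n → Run (.seq c d) s s₂ (m + n)
  | casePop {r k s s' n} : Run (k (s r).head?) (update s r (s r).tail) s' n →
      Run (.casePop r k) s s' (n + 1)
  | loopNil {r k s} : s r = [] → Run (.loop r k) s s 1
  | loopCons {r k s s₁ s₂ b l m n} : s r = b :: l → Run (k b) (update s r l) s₁ m →
      Run (.loop r k) s₁ s₂ n → Run (.loop r k) s s₂ (m + n + 1)

namespace Cmd

variable {R : Type}

/-- Control points of a program. -/
def Pos : Cmd R → Type
  | skip => Unit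
  | push _ _ => Unit
  | seq c d => Pos c ⊕ Pos d
  | casePop _ k => Option (Σ o, Pos (k o))
  | loop _ k => Option (Σ b, Pos (k b))

/-- The first control point of a program. -/
def entry : (c : Cmd R) → Pos c
  | skip => ()
  | push _ _ => ()
  | seq c _ => Sum.inl (entry c)
  | casePop _ _ => none
  | loop _ _ => none

instance finite_pos (c : Cmd R) : Finite (Pos c) := by
  induction c with
  | skip => exact inferInstanceAs (Finite Unit)
  | push => exact inferInstanceAs (Finite Unit)
  | seq c d hc hd => exact inferInstanceAs (Finite (Pos c ⊕ Pos d))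
  | casePop r k h => exact inferInstanceAs (Finite (Option (Σ o, Pos (k o))))
  | loop r k h => exact inferInstanceAs (Finite (Option (Σ o, Pos (k o))))

/-- Stack alphabets of a machine with the registers in `R` and further stacks. -/
abbrev Alph (R : Type) {K : Type} (Γ : K → Type) : R ⊕ K → Type := Sum.elim (fun _ => Bool) Γ

/-- Stacks of a machine with the registers in `R` and further stacks. -/
def join {K : Type} {Γ : K → Type} (s : Store R) (T : ∀ k, List (Γ k)) :
    ∀ k, List (Alph R Γ k)
  | Sum.inl r => s r
  | Sum.inr k => T k

section
variable {K : Type} [DecidableEq R] [DecidableEq K] {Γ : K → Type}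

theorem update_join_inl (s : Store R) (T : ∀ k, List (Γ k)) (r : R) (l : List Bool) :
    update (join s T) (Sum.inl r) l = join (update s r l) T := by
  funext k
  rcases k with k | k
  · by_cases h : k = r
    · subst h
      exact (update_self (Sum.inl k) l (join s T)).trans (update_self k l s).symm
    · have h₁ := update_of_ne (β := fun k => List (Alph R Γ k)) (a := Sum.inl k)
        (a' := Sum.inl r) (by simpa using h) l (join s T)
      have h₂ := update_of_ne h l s
      exact h₁.trans h₂.symm
  · exact update_of_ne (β := fun k => List (Alph R Γ k)) (a := Sum.inr k) (a' := Sum.inl r)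
      (by simp) l (join s T)

theorem update_join_inr (s : Store R) (T : ∀ k, List (Γ k)) (k : K) (l : List (Γ k)) :
    update (join s T) (Sum.inr k) l = join s (update T k l) := by
  funext j
  rcases j with j | j
  · exact update_of_ne (β := fun k => List (Alph R Γ k)) (a := Sum.inl j) (a' := Sum.inr k)
      (by simp) l (join s T)
  · by_cases h : j = k
    · subst h
      exact (update_self (Sum.inr j) l (join s T)).trans (update_self j l T).symm
    · have h₁ := update_of_ne (β := fun k => List (Alph R Γ k)) (a := Sum.inr j)
        (a' := Sum.inr k) (by simpa using h) l (join s T)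
      have h₂ := update_of_ne h l T
      exact h₁.trans h₂.symm

end

/-- The statements of the compiled program. -/
def code {K : Type} {Γ : K → Type} {Λ σ : Type} :
    (c : Cmd R) → (Pos c → Λ) → Λ → Pos c → TM2.Stmt (Alph R Γ) Λ (Option Bool × σ)
  | skip, _, ex => fun _ => .goto fun _ => ex
  | push r b, _, ex => fun _ => .push (Sum.inl r) (fun _ => b) (.goto fun _ => ex)
  | seq c d, emb, ex => fun p => match p with
    | .inl p => code c (fun q => emb (.inl q)) (emb (.inr (entry d))) p
    | .inr p => code d (fun q => emb (.inr q)) ex p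
  | casePop r k, emb, ex => fun p => match p with
    | none => .pop (Sum.inl r) (fun v a => (a, v.2)) (.goto fun v => emb (some ⟨v.1, entry (k v.1)⟩))
    | some ⟨o, p⟩ => code (k o) (fun q => emb (some ⟨o, q⟩)) ex p
  | loop r k, emb, ex => fun p => match p with
    | none => .pop (Sum.inl r) (fun v a => (a, v.2))
        (.goto fun v => v.1.elim ex fun b => emb (some ⟨b, entry (k b)⟩))
    | some ⟨b, p⟩ => code (k b) (fun q => emb (some ⟨b, q⟩)) (emb none) p

end Cmd

/-- `n` steps of the partial function `f` lead from `a` to `b`. -/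
def Reach {C : Type} (f : C → Option C) (a b : C) (n : ℕ) : Prop :=
  (flip bind f)^[n] (some a) = some b

theorem Reach.trans {C : Type} {f : C → Option C} {a b c : C} {m n : ℕ} (h : Reach f a b m)
    (h' : Reach f b c n) : Reach f a c (m + n) := by
  unfold Reach at *
  rw [Nat.add_comm, iterate_add_apply, h, h']

theorem Reach.single {C : Type} {f : C → Option C} {a b : C} (h : f a = some b) :
    Reach f a b 1 := h

open Cmd

/-- The embedding of control points and the exit label are arbitrary, so that the induction can
place a subprogram inside a larger machine; `M` need only agree with the compiled code on the image
of `emb`. The step counts agree exactly, since a `TM2` step executes a whole statement up to its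
`goto`. Only the scratch variable is left unspecified at the end. -/
theorem Run.reach {R K : Type} [DecidableEq R] [DecidableEq K] {Γ : K → Type} {Λ σ : Type}
    {c : Cmd R} {s s' : Store R} {n : ℕ} (h : Run c s s' n) :
    ∀ (emb : Pos c → Λ) (ex : Λ) (M : Λ → TM2.Stmt (Alph R Γ) Λ (Option Bool × σ)),
      (∀ p, M (emb p) = code c emb ex p) → ∀ (v : Option Bool) (w : σ) (T : ∀ k, List (Γ k)),
      ∃ v', Reach (TM2.step M) ⟨some (emb (entry c)), (v, w), join s T⟩
        ⟨some ex, (v', w), join s' T⟩ n := by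
  induction h with
  | skip s =>
    intro emb ex M hM v w T
    refine ⟨v, Reach.single ?_⟩
    simp [TM2.step, hM, code]
  | push r b s =>
    intro emb ex M hM v w T
    refine ⟨v, Reach.single ?_⟩
    simp only [TM2.step, hM, code, TM2.stepAux]
    rw [← update_join_inl]
    rfl
  | @seq c d s s₁ s₂ m n _ _ ihc ihd =>
    intro emb ex M hM v w T
    obtain ⟨v₁, h₁⟩ := ihc (fun q => emb (.inl q)) (emb (.inr (entry d))) M
      (fun p => hM (.inl p)) v w T
    obtain ⟨v₂, h₂⟩ := ihd (fun q => emb (.inr q)) ex M (fun p => hM (.inr p)) v₁ w T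
    exact ⟨v₂, h₁.trans h₂⟩
  | @casePop r k s s' n _ ih =>
    intro emb ex M hM v w T
    obtain ⟨v₁, h₁⟩ := ih (fun q => emb (some ⟨_, q⟩)) ex M
      (fun p => (hM (some ⟨_, p⟩)).trans (by rw [code]))
      (s r).head? w T
    refine ⟨v₁, ?_⟩
    rw [Nat.add_comm]
    refine Reach.trans (Reach.single ?_) h₁
    have := hM none
    simp only [TM2.step, entry, this, code, TM2.stepAux]
    rw [← update_join_inl]
    rfl
  | @loopNil r k s h =>
    intro emb ex M hM v w T
    refine ⟨none, Reach.single ?_⟩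
    have := hM none
    simp only [TM2.step, entry, this, code, TM2.stepAux]
    have h1 : join (Γ := Γ) s T (Sum.inl r) = [] := h
    simp only [h1, List.head?_nil, List.tail_nil, Option.elim]
    -- Popping an empty register leaves the store unchanged.
    have := update_join_inl (Γ := Γ) s T r []
    rw [← h, update_eq_self, h] at this
    congr 2
  | @loopCons r k s s₁ s₂ b l m n h _ _ ih₁ ih₂ =>
    intro emb ex M hM v w T
    obtain ⟨v₁, h₁⟩ := ih₁ (fun q => emb (some ⟨_, q⟩)) (emb none) M
      (fun p => (hM (some ⟨_, p⟩)).trans (by rw [code]))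
      (some b) w T
    obtain ⟨v₂, h₂⟩ := ih₂ emb ex M hM v₁ w T
    refine ⟨v₂, ?_⟩
    rw [Nat.add_comm]
    refine Reach.trans (Reach.single ?_) (h₁.trans h₂)
    have := hM none
    simp only [TM2.step, entry, this, code, TM2.stepAux]
    have h1 : join (Γ := Γ) s T (Sum.inl r) = b :: l := h
    simp only [h1, Option.elim]
    rw [← update_join_inl]
    rfl

/-- A statement acting on the further stacks of a machine with registers. -/
def liftStmt (R : Type) {K : Type} {Γ : K → Type} {Λ Λ' σ : Type} (emb : Λ → Λ') :
    TM2.Stmt Γ Λ σ → TM2.Stmt (Alph R Γ) Λ' (Option Bool × σ)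
  | .push k f q => .push (Sum.inr k) (fun v => f v.2) (liftStmt R emb q)
  | .peek k f q => .peek (Sum.inr k) (fun v a => (v.1, f v.2 a)) (liftStmt R emb q)
  | .pop k f q => .pop (Sum.inr k) (fun v a => (v.1, f v.2 a)) (liftStmt R emb q)
  | .load f q => .load (fun v => (v.1, f v.2)) (liftStmt R emb q)
  | .branch f q₁ q₂ => .branch (fun v => f v.2) (liftStmt R emb q₁) (liftStmt R emb q₂)
  | .goto f => .goto fun v => emb (f v.2)
  | .halt => .halt

/-- A configuration of a machine, seen inside a machine with registers. -/
def liftCfg {R K : Type} {Γ : K → Type} {Λ Λ' σ : Type} (emb : Λ → Λ') (s : Store R)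
    (v : Option Bool) (c : TM2.Cfg Γ Λ σ) : TM2.Cfg (Alph R Γ) Λ' (Option Bool × σ) :=
  ⟨c.l.map emb, (v, c.var), join s c.stk⟩

theorem stepAux_liftStmt {R K : Type} [DecidableEq R] [DecidableEq K] {Γ : K → Type}
    {Λ Λ' σ : Type} (emb : Λ → Λ') (s : Store R) (v : Option Bool) (q : TM2.Stmt Γ Λ σ) :
    ∀ (w : σ) (T : ∀ k, List (Γ k)),
      TM2.stepAux (liftStmt R emb q) (v, w) (join s T) = liftCfg emb s v (TM2.stepAux q w T) := by
  induction q with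
  | push k f q ih =>
    intro w T
    rw [TM2.stepAux, ← ih, ← update_join_inr]; rfl
  | peek k f q ih => intro w T; rw [TM2.stepAux, ← ih]; rfl
  | pop k f q ih =>
    intro w T
    rw [TM2.stepAux, ← ih, ← update_join_inr]; rfl
  | load f q ih => intro w T; rw [TM2.stepAux, ← ih]; rfl
  | branch f q₁ q₂ ih₁ ih₂ =>
    intro w T
    simp only [liftStmt, TM2.stepAux]
    cases f w
    · exact ih₂ w T
    · exact ih₁ w T
  | goto f => intro w T; rfl
  | halt => intro w T; rfl

/-- Lifting configurations semiconjugates the two step functions, hence also their iterates. -/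
theorem reach_lift {R K : Type} [DecidableEq R] [DecidableEq K] {Γ : K → Type}
    {Λ Λ' σ : Type} (emb : Λ → Λ') (s : Store R) (v : Option Bool) (M : Λ → TM2.Stmt Γ Λ σ)
    (M' : Λ' → TM2.Stmt (Alph R Γ) Λ' (Option Bool × σ))
    (hM : ∀ l, M' (emb l) = liftStmt R emb (M l)) (n : ℕ) :
    ∀ {a b : TM2.Cfg Γ Λ σ}, Reach (TM2.step M) a b n →
      Reach (TM2.step M') (liftCfg emb s v a) (liftCfg emb s v b) n := by
  have key : ∀ a : TM2.Cfg Γ Λ σ, TM2.step M' (liftCfg emb s v a) =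
      (TM2.step M a).map (liftCfg emb s v) := by
    rintro ⟨l, w, T⟩
    cases l with
    | none => rfl
    | some l =>
      simp only [liftCfg, Option.map_some, TM2.step, hM, stepAux_liftStmt]
  have key2 : ∀ o : Option (TM2.Cfg Γ Λ σ), (flip bind (TM2.step M')) (o.map (liftCfg emb s v)) =
      ((flip bind (TM2.step M)) o).map (liftCfg emb s v) := by
    rintro (_ | a)
    · rfl
    · exact key a
  have key3 := fun o => (Semiconj.iterate_right (f := Option.map (liftCfg (R := R) emb s v))
    (fun o => (key2 o).symm) n) o
  intro a b h
  unfold Reach at *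
  have := key3 (some a)
  rw [h] at this
  exact this.symm

theorem initList_eq (tm : FinTM2) (s : List (tm.Γ tm.k₀)) :
    initList tm s = ⟨some tm.main, tm.initialState, update (fun _ => []) tm.k₀ s⟩ := by
  unfold initList
  congr 1
  funext k
  by_cases h : k = tm.k₀
  · subst h; simp
  · simp [h]

theorem haltList_eq (tm : FinTM2) (s : List (tm.Γ tm.k₁)) :
    haltList tm s = ⟨none, tm.initialState, update (fun _ => []) tm.k₁ s⟩ := by
  unfold haltList
  congr 1
  funext k
  by_cases h : k = tm.k₁
  · subst h; simp
  · simp [h]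

/-- The store with a single nonempty register. -/
def single {R : Type} [DecidableEq R] (r : R) (l : List Bool) : Store R := update (fun _ => []) r l

/-! ### Running a stack program before a given machine -/

section Compose

variable {R : Type} [DecidableEq R] [Fintype R] {α : Type}

/-- The machine that runs `c`, moves its output register to the input stack of `tm`, and then runs
`tm`. -/
noncomputable def composeTM (c : Cmd R) (rin rout : R) (tm : FinTM2) (e : tm.Γ tm.k₀ ≃ Bool) :
    FinTM2 :=
  letI : DecidableEq tm.K := tm.kDecidableEq
  letI : Fintype tm.K := tm.kFin
  letI : Fintype tm.Λ := tm.ΛFin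
  letI : Fintype tm.σ := tm.σFin
  letI : Fintype (Pos c) := Fintype.ofFinite _
  { K := R ⊕ tm.K
    k₀ := .inl rin
    k₁ := .inr tm.k₁
    Γ := Alph R tm.Γ
    Λ := Pos c ⊕ (Unit ⊕ tm.Λ)
    main := .inl (entry c)
    σ := Option Bool × tm.σ
    initialState := (none, tm.initialState)
    Γk₀Fin := inferInstanceAs (Fintype Bool)
    m := fun l => match l with
      | .inl p => code c .inl (.inr (.inl ())) p
      | .inr (.inl _) => .pop (.inl rout) (fun v a => (a, v.2))
          (.branch (fun v => v.1.isSome)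
            (.push (.inr tm.k₀) (fun v => e.symm (v.1.getD false))
              (.goto fun _ => .inr (.inl ())))
            (.goto fun _ => .inr (.inr tm.main)))
      | .inr (.inr l) => liftStmt R (fun l => .inr (.inr l)) (tm.m l) }

/-- Moving a stack symbol by symbol reverses it, which is why programs leave their output reversed.
The final unsuccessful pop resets the scratch variable to `none`, its initial value, as the halting
configuration will require. -/
theorem composeTM_transfer (c : Cmd R) (rin rout : R) (tm : FinTM2) (e : tm.Γ tm.k₀ ≃ Bool)
    (l : List Bool) : ∀ (acc : List (tm.Γ tm.k₀)) (v : Option Bool),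
    Reach (composeTM c rin rout tm e).step
      ⟨some (.inr (.inl ())), (v, tm.initialState),
        join (single rout l) (update (fun _ => []) tm.k₀ acc)⟩
      ⟨some (.inr (.inr tm.main)), (none, tm.initialState),
        join (fun _ => []) (update (fun _ => []) tm.k₀ (l.reverse.map e.symm ++ acc))⟩
      (l.length + 1) := by
  induction l with
  | nil =>
    intro acc v
    have h0 : single rout [] = fun _ => [] := update_eq_self rout _
    rw [h0]
    refine Reach.single ?_
    simp only [FinTM2.step, TM2.step, composeTM, TM2.stepAux]
    have h : join (Γ := tm.Γ) (fun _ => []) (update (fun _ => []) tm.k₀ acc) (Sum.inl rout)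
      = [] := rfl
    simp only [h, List.head?_nil, List.tail_nil, Option.isSome, cond_false]
    have h2 := update_join_inl (Γ := tm.Γ) (fun _ => []) (update (fun _ => []) tm.k₀ acc) rout []
    rw [show update (fun _ => []) rout [] = (fun _ => [] : Store R) from update_eq_self rout _] at h2
    exact congrArg (fun S => some (TM2.Cfg.mk _ _ S)) h2
  | cons b l ih =>
    intro acc v
    rw [List.length_cons, Nat.add_comm (l.length + 1) 1]
    refine Reach.trans (b := ⟨some (.inr (.inl ())), (some b, tm.initialState),
        join (single rout l) (update (fun _ => []) tm.k₀ (e.symm b :: acc))⟩)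
        (Reach.single ?_) ?_
    · simp only [FinTM2.step, TM2.step, composeTM, TM2.stepAux]
      have h : join (Γ := tm.Γ) (single rout (b :: l)) (update (fun _ => []) tm.k₀ acc)
        (Sum.inl rout) = b :: l := by simp [join, single]
      simp only [h]
      have h₂ : update (join (single rout (b :: l)) (update (fun _ => []) tm.k₀ acc))
          (Sum.inl rout) l = join (Γ := tm.Γ) (single rout l) (update (fun _ => []) tm.k₀ acc) := by
        rw [update_join_inl, single, update_idem]
        rfl
      have h₃ := update_join_inr (Γ := tm.Γ) (single rout l) (update (fun _ => []) tm.k₀ acc)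
        tm.k₀ (e.symm b :: acc)
      rw [update_idem] at h₃
      have h₄ : update (join (Γ := tm.Γ) (single rout l) (update (fun _ => []) tm.k₀ acc))
          (Sum.inr tm.k₀) (e.symm b :: join (Γ := tm.Γ) (single rout l)
            (update (fun _ => []) tm.k₀ acc) (Sum.inr tm.k₀)) =
          join (single rout l) (update (fun _ => []) tm.k₀ (e.symm b :: acc)) := by
        rw [← h₃]
        simp only [join, update_self]
        rfl
      rw [← h₂] at h₄
      exact congrArg (fun S => some (TM2.Cfg.mk _ _ S)) h₄
    · have := ih (e.symm b :: acc) (some b)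
      simpa using this

/-- A halting configuration prescribes that all stacks but the output are empty. This is why the
program has to finish with every register except `rout` cleared. -/
theorem composeTM_reach {c : Cmd R} {rin rout : R} {tm : FinTM2} (e : tm.Γ tm.k₀ ≃ Bool)
    {x y : List Bool} {z : List (tm.Γ tm.k₁)} {m n : ℕ}
    (hc : Run c (single rin x) (single rout y.reverse) m)
    (ht : Reach tm.step (initList tm (y.map e.symm)) (haltList tm z) n) :
    Reach (composeTM c rin rout tm e).step (initList (composeTM c rin rout tm e) x)
      (haltList (composeTM c rin rout tm e) z) (m + (y.length + 1) + n) := by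
  obtain ⟨v, h₁⟩ := hc.reach (Γ := tm.Γ) (σ := tm.σ) (K := tm.K)
    (Λ := Pos c ⊕ (Unit ⊕ tm.Λ)) .inl (.inr (.inl ())) (composeTM c rin rout tm e).m
    (fun p => rfl) none tm.initialState (fun _ => [])
  have h₂ := composeTM_transfer c rin rout tm e y.reverse [] v
  have h₃ := reach_lift (R := R) (Λ' := Pos c ⊕ (Unit ⊕ tm.Λ)) (fun l => .inr (.inr l))
    (fun _ => []) none tm.m (composeTM c rin rout tm e).m (fun l => rfl) n ht
  rw [initList_eq, haltList_eq] at h₃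
  rw [List.length_reverse, List.reverse_reverse, List.append_nil] at h₂
  have hnil : ∀ k : tm.K, update (fun k => ([] : List (tm.Γ k))) k [] = fun _ => [] := by
    intro k; exact update_eq_self k _
  rw [hnil] at h₂
  have e1 : (join (single rin x) (fun _ => []) : ∀ k, List (Alph R tm.Γ k)) =
      update (fun k => ([] : List (Alph R tm.Γ k))) (Sum.inl rin) x := by
    have := update_join_inl (Γ := tm.Γ) (fun _ : R => []) (fun _ => []) rin x
    rw [single, ← this]
    congr 1
    funext k; rcases k with k | k <;> rfl
  have e2 : (join (fun _ => []) (update (fun _ => []) tm.k₁ z) : ∀ k, List (Alph R tm.Γ k)) =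
      update (fun k => ([] : List (Alph R tm.Γ k))) (Sum.inr tm.k₁) z := by
    have := update_join_inr (Γ := tm.Γ) (fun _ : R => []) (fun _ => []) tm.k₁ z
    rw [← this]
    congr 1
    funext k; rcases k with k | k <;> rfl
  have h₄ := (h₁.trans h₂).trans h₃
  rw [e1] at h₄
  simp only [liftCfg, e2] at h₄
  exact (congrArg₂ (fun a b => Reach (composeTM c rin rout tm e).step a b
    (m + (y.length + 1) + n)) (initList_eq (composeTM c rin rout tm e) x)
    (haltList_eq (composeTM c rin rout tm e) z)).mpr h₄

end Compose

/-- A function on bit strings is computed by a stack program in polynomial time. The output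
register holds the output in reversed order, since it is read off from the top. -/
def ProgComputable (f : List Bool → List Bool) : Prop :=
  ∃ (R : Type) (_ : DecidableEq R) (_ : Fintype R) (c : Cmd R) (rin rout : R) (p : Polynomial ℕ),
    ∀ x, ∃ n ≤ p.eval x.length, Run c (single rin x) (single rout (f x).reverse) n

/-- A step pushes at most one bit, so running time bounds the growth of each register. -/
theorem Run.length_le {R : Type} [DecidableEq R] {c : Cmd R} {s s' : Store R} {n : ℕ}
    (h : Run c s s' n) : ∀ (l : ℕ), (∀ r, (s r).length ≤ l) → ∀ r, (s' r).length ≤ l + n := by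
  induction h with
  | skip s => intro l hl r; exact (hl r).trans (Nat.le_add_right _ _)
  | push r b s =>
    intro l hl r'
    by_cases h : r' = r
    · subst h; simpa using hl r'
    · simpa [h] using (hl r').trans (Nat.le_add_right _ _)
  | seq _ _ ih₁ ih₂ =>
    intro l hl r
    rw [← Nat.add_assoc]
    exact ih₂ _ (ih₁ _ hl) r
  | @casePop r k s s' n _ ih =>
    intro l hl r'
    refine (ih l ?_ r').trans (by omega)
    intro r'
    by_cases h : r' = r
    · subst h; simpa using (hl r').trans (Nat.le_add_right _ _)
    · simpa [h] using hl r'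
  | loopNil h => intro l hl r; exact (hl r).trans (Nat.le_add_right _ _)
  | @loopCons r k s s₁ s₂ b t m n h _ _ ih₁ ih₂ =>
    intro l hl r'
    refine (ih₂ _ (ih₁ l ?_) r').trans (by omega)
    intro r'
    by_cases h' : r' = r
    · subst h'
      have := hl r'
      rw [h] at this
      simp at this ⊢
      omega
    · simpa [h'] using hl r'

theorem ProgComputable.length_le {f : List Bool → List Bool} (hf : ProgComputable f) :
    ∃ p : Polynomial ℕ, ∀ x, (f x).length ≤ p.eval x.length := by
  obtain ⟨R, _, _, c, rin, rout, p, h⟩ := hf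
  refine ⟨Polynomial.X + p, fun x => ?_⟩
  obtain ⟨n, hn, hr⟩ := h x
  have := hr.length_le x.length (fun r => by
    by_cases hr : r = rin
    · subst hr; simp [single]
    · simp [single, hr]) rout
  simp only [single, update_self, List.length_reverse] at this
  simp only [Polynomial.eval_add, Polynomial.eval_X]
  omega

theorem Polynomial.eval_mono_nat (p : Polynomial ℕ) {a b : ℕ} (h : a ≤ b) :
    p.eval a ≤ p.eval b := by
  rw [Polynomial.eval_eq_sum_range, Polynomial.eval_eq_sum_range]
  gcongr

theorem ProgComputable.compose {α β : Type} {f : List Bool → List Bool} {h : List Bool → α}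
    {ea : α → List Bool} {eb : β → List Bool} {g : α → β} (hf : ProgComputable f)
    (hg : Nonempty (TM2ComputableInPolyTime ea eb g)) (hfh : ∀ x, f x = ea (h x)) :
    Nonempty (TM2ComputableInPolyTime (id : List Bool → List Bool) eb (fun x => g (h x))) := by
  obtain ⟨q, hq⟩ := hf.length_le
  obtain ⟨R, _, _, c, rin, rout, p, hc⟩ := hf
  obtain ⟨M⟩ := hg
  -- The summands of the time bound are the program, the transfer of its output, and the machine on
  -- an input of length at most `q`.
  refine ⟨{ tm := composeTM c rin rout M.tm M.inputAlphabet
            inputAlphabet := Equiv.refl Bool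
            outputAlphabet := M.outputAlphabet
            time := p + (q + 1) + M.time.comp q
            outputsFun := fun x => ?_ }⟩
  have hx := hc x
  choose m hm hrun using hx
  obtain ⟨⟨n, hn⟩, hnt⟩ := M.outputsFun (h x)
  have h₁ := composeTM_reach M.inputAlphabet hrun (z := List.map M.outputAlphabet.invFun
    (eb (g (h x)))) (n := n) (by
      rw [hfh x]
      exact hn)
  refine ⟨⟨m + ((f x).length + 1) + n, ?_⟩, ?_⟩
  · have : List.map (Equiv.refl Bool).invFun x = x := by simp
    refine Eq.trans ?_ h₁
    congr 2
    exact congrArg _ this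
  · have h2 := Polynomial.eval_mono_nat M.time (hq x)
    have h3 := hq x
    have h4 : n ≤ M.time.eval (f x).length := by rw [hfh x]; exact hnt
    simp only [Polynomial.eval_add, Polynomial.eval_one, Polynomial.eval_comp, id]
    omega

end RobustlyOften

/-! ### Rules for the execution of stack programs within a time bound -/

namespace RobustlyOften

open Turing Function

/-- The program `c` leads from `s` to `s'` in at most `B` steps. -/
def Exec {R : Type} [DecidableEq R] (c : Cmd R) (s s' : Store R) (B : ℕ) : Prop :=
  ∃ n ≤ B, Run c s s' n

namespace Exec

variable {R : Type} [DecidableEq R] {s s' s₁ s₂ : Store R} {c d : Cmd R} {B B' : ℕ} {r : R}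

theorem mono (h : Exec c s s' B) (hB : B ≤ B') : Exec c s s' B' := by
  obtain ⟨n, hn, hr⟩ := h
  exact ⟨n, hn.trans hB, hr⟩

theorem congr (h : Exec c s s' B) (hs : s' = s₁) : Exec c s s₁ B := hs ▸ h

theorem skip : Exec .skip s s 1 := ⟨1, le_rfl, .skip s⟩

theorem push {b : Bool} (h : update s r (b :: s r) = s') : Exec (.push r b) s s' 1 :=
  h ▸ ⟨1, le_rfl, .push r b s⟩

theorem seq (h : Exec c s s₁ B) (h' : Exec d s₁ s₂ B') : Exec (.seq c d) s s₂ (B + B') := by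
  obtain ⟨n, hn, hr⟩ := h
  obtain ⟨m, hm, hr'⟩ := h'
  exact ⟨n + m, Nat.add_le_add hn hm, .seq hr hr'⟩

theorem casePop {k : Option Bool → Cmd R} (o : Option Bool) (ho : (s r).head? = o)
    (hs : update s r (s r).tail = s₁) (h : Exec (k o) s₁ s' B) :
    Exec (.casePop r k) s s' (B + 1) := by
  subst ho hs
  obtain ⟨n, hn, hr⟩ := h
  exact ⟨n + 1, by omega, .casePop hr⟩

theorem loopNil {k : Bool → Cmd R} (h : s r = []) : Exec (.loop r k) s s 1 :=
  ⟨1, le_rfl, .loopNil h⟩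

theorem loopCons {k : Bool → Cmd R} {b : Bool} {l : List Bool} (h : s r = b :: l)
    (h₁ : Exec (k b) (update s r l) s₁ B) (h₂ : Exec (.loop r k) s₁ s₂ B') :
    Exec (.loop r k) s s₂ (B + B' + 1) := by
  obtain ⟨n, hn, hr⟩ := h₁
  obtain ⟨m, hm, hr'⟩ := h₂
  exact ⟨n + m + 1, by omega, .loopCons h hr hr'⟩

/-- A loop whose body leaves its control register alone, with the state described in terms of the
bits already read and the bits still to be read. -/
theorem loop {k : Bool → Cmd R} (L : List Bool) (S : List Bool → List Bool → Store R)
    (hr : ∀ p l, S p l r = l)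
    (hstep : ∀ p b l, p ++ b :: l = L →
      Exec (k b) (update (S p (b :: l)) r l) (S (p ++ [b]) l) B) :
    Exec (.loop r k) (S [] L) (S L []) ((B + 1) * L.length + 1) := by
  have key : ∀ l p, p ++ l = L → Exec (.loop r k) (S p l) (S L []) ((B + 1) * l.length + 1) := by
    intro l
    induction l with
    | nil =>
      intro p hp
      rw [List.append_nil] at hp
      subst hp
      exact (loopNil (hr _ _)).mono (by simp)
    | cons b l ih =>
      intro p hp
      refine (loopCons (hr _ _) (hstep p b l hp) (ih (p ++ [b]) (by simpa using hp))).mono ?_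
      simp only [List.length_cons]
      ring_nf
      omega
  exact key L [] rfl

end Exec

namespace Cmd

variable {R : Type}

/-- Empty the register `a`. -/
def clear (a : R) : Cmd R := loop a fun _ => skip

/-- Move the contents of `a` to `b`, reversing the order. -/
def moveRev (a b : R) : Cmd R := loop a fun x => push b x

/-- Put a copy of the contents of `a` on top of `b`; the register `t` is auxiliary. -/
def copyTo (a b t : R) : Cmd R := seq (moveRev a t) (loop t fun x => seq (push a x) (push b x))

end Cmd

open Cmd

section Macros

variable {R : Type} [DecidableEq R]

theorem exec_clear (a : R) (s : Store R) :
    Exec (clear a) s (update s a []) (2 * (s a).length + 1) := by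
  have := Exec.loop (r := a) (k := fun _ => skip) (B := 1) (s a) (fun _ l => update s a l)
    (fun _ _ => update_self _ _ _) (fun p b l _ => by simpa using Exec.skip)
  rw [update_eq_self] at this
  exact this

theorem exec_moveRev {a b : R} (hab : a ≠ b) (s : Store R) :
    Exec (moveRev a b) s (update (update s a []) b ((s a).reverse ++ s b))
      (2 * (s a).length + 1) := by
  have := Exec.loop (r := a) (k := fun x => push b x) (B := 1) (s a)
    (fun p l => update (update s a l) b (p.reverse ++ s b))
    (fun p l => by simp [hab]) (fun p x l _ => Exec.push (by
      funext r
      by_cases h₁ : r = b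
      · subst h₁; simp [hab.symm]
      · by_cases h₂ : r = a
        · subst h₂; simp [hab]
        · simp [h₁, h₂]))
  simpa [moveRev] using this

theorem exec_copyTo {a b t : R} (hab : a ≠ b) (hat : a ≠ t) (hbt : b ≠ t) (s : Store R)
    (ht : s t = []) :
    Exec (copyTo a b t) s (update s b (s a ++ s b)) (5 * (s a).length + 2) := by
  have h₁ := exec_moveRev hat s
  have h₂ := Exec.loop (r := t) (k := fun x => seq (push a x) (push b x)) (B := 2) (s a).reverse
    (fun p l => update (update (update s t l) a p.reverse) b (p.reverse ++ s b))
    (fun p l => by simp [hat.symm, hbt.symm]) (fun p x l _ => Exec.seq (Exec.push rfl) (Exec.push (by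
      funext r
      by_cases k₁ : r = b
      · subst k₁; simp [hab.symm, hbt]
      · by_cases k₂ : r = a
        · subst k₂; simp [hab, hat]
        · by_cases k₃ : r = t
          · subst k₃; simp [k₁, k₂]
          · simp [k₁, k₂, k₃])))
  have e : update (update (update s t (s a).reverse) a [].reverse) b ([].reverse ++ s b) =
      update (update s a []) t ((s a).reverse ++ s t) := by
    funext r
    by_cases k₁ : r = b
    · subst k₁; simp [hab.symm, hbt]
    · by_cases k₂ : r = a
      · subst k₂; simp [hab, hat]
      · by_cases k₃ : r = t
        · subst k₃; simp [hat.symm, hbt.symm, ht]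
        · simp [k₁, k₂, k₃]
  rw [e] at h₂
  refine ((h₁.seq h₂).mono ?_).congr ?_
  · simp; omega
  · funext r
    by_cases k₁ : r = b
    · subst k₁; simp
    · by_cases k₂ : r = a
      · subst k₂; simp [hab]
      · by_cases k₃ : r = t
        · subst k₃; simp [hat.symm, hbt.symm, ht]
        · simp [k₁, k₂, k₃]

end Macros

/-! ### Bit clauses: an `NP` problem with a simple verifier -/

/-- The instructions of a bit clause formula, read along a bit string. -/
inductive Tok
  | star
  | sep
  | lit (b : Bool)
  | req (b : Bool)

/-- Three-bit encoding of the instructions. -/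
def Tok.bits : Tok → List Bool
  | star => [false, false, false]
  | sep => [false, true, false]
  | lit b => [true, false, b]
  | req b => [true, true, b]

/-- Check the bit string `Y` against an encoded formula: `star` skips a bit, `lit b` makes the
current clause true if the bit is `b`, `req b` demands that the bit is `b`, and `sep` demands that
the current clause is true and starts over at the beginning of `Y`. -/
def check (Y : List Bool) : List Bool → List Bool → Bool → Bool → Bool
  | false :: false :: _ :: t, Z, fl, ok => check Y t Z.tail fl ok
  | false :: true :: _ :: t, _, fl, ok => check Y t Y false (ok && fl)
  | true :: false :: b :: t, Z, fl, ok => check Y t Z.tail (fl || (Z.head? == some b)) ok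
  | true :: true :: b :: t, Z, fl, ok => check Y t Z.tail fl (ok && (Z.head? == some b))
  | [], _, _, ok => ok
  | [_], _, _, ok => ok
  | [_, _], _, _, ok => ok

/-- The inverse of `pair`. -/
def unpair : List Bool → List Bool × List Bool
  | a :: b :: t => if a = b then (a :: (unpair t).1, (unpair t).2) else ([], t)
  | _ => ([], [])

theorem unpair_pair (x y : List Bool) : unpair (pair x y) = (x, y) := by
  induction x with
  | nil => simp [pair, unpair]
  | cons a x ih =>
    have : pair (a :: x) y = a :: a :: pair x y := by simp [pair]
    rw [this, unpair, if_pos rfl, ih]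

theorem unpair_length (z : List Bool) :
    2 * (unpair z).1.length + (unpair z).2.length ≤ z.length := by
  induction z using unpair.induct with
  | case1 b t ih => simp [unpair]; omega
  | case2 a b t h => simp [unpair, h]; omega
  | case3 z h =>
    rcases z with _ | ⟨a, _ | ⟨b, t⟩⟩
    · simp [unpair]
    · simp [unpair]
    · exact absurd rfl (h a b t)

/-- The verifier of bit clause formulas. -/
def verify (z : List Bool) : Bool :=
  check (unpair z).2 (unpair z).1 (unpair z).2 true true

/-- Satisfiable bit clause formulas. -/
def clauseSat : Language Bool :=
  {x | ∃ y : List Bool, y.length ≤ x.length ∧ check y x y true true = true}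

/-- Registers of the verifier. -/
inductive VReg
  | Y | XR | X | Z | T | C | FL | BAD | OUT
  deriving DecidableEq

instance : Fintype VReg where
  elems := {.Y, .XR, .X, .Z, .T, .C, .FL, .BAD, .OUT}
  complete r := by cases r <;> decide

/-- A store of the verifier. -/
def vst (y xr x z t c fl bad out : List Bool) : Store VReg
  | .Y => y
  | .XR => xr
  | .X => x
  | .Z => z
  | .T => t
  | .C => c
  | .FL => fl
  | .BAD => bad
  | .OUT => out

section
variable (y xr x z t c fl bad out l : List Bool)

@[simp] theorem update_vst_Y : update (vst y xr x z t c fl bad out) .Y l =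
    vst l xr x z t c fl bad out := by funext r; cases r <;> rfl
@[simp] theorem update_vst_XR : update (vst y xr x z t c fl bad out) .XR l =
    vst y l x z t c fl bad out := by funext r; cases r <;> rfl
@[simp] theorem update_vst_X : update (vst y xr x z t c fl bad out) .X l =
    vst y xr l z t c fl bad out := by funext r; cases r <;> rfl
@[simp] theorem update_vst_Z : update (vst y xr x z t c fl bad out) .Z l =
    vst y xr x l t c fl bad out := by funext r; cases r <;> rfl
@[simp] theorem update_vst_C : update (vst y xr x z t c fl bad out) .C l =
    vst y xr x z t l fl bad out := by funext r; cases r <;> rfl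
@[simp] theorem update_vst_FL : update (vst y xr x z t c fl bad out) .FL l =
    vst y xr x z t c l bad out := by funext r; cases r <;> rfl
@[simp] theorem update_vst_BAD : update (vst y xr x z t c fl bad out) .BAD l =
    vst y xr x z t c fl l out := by funext r; cases r <;> rfl
@[simp] theorem update_vst_OUT : update (vst y xr x z t c fl bad out) .OUT l =
    vst y xr x z t c fl bad l := by funext r; cases r <;> rfl

end

/-- The contents of a register that holds a truth value. -/
def flag (b : Bool) : List Bool := if b then [true] else []

/-- Split the input pair into `XR` (reversed) and `Y`. -/
def splitCmd : Cmd VReg :=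
  .loop .C fun _ => .casePop .Y fun o₁ => .casePop .Y fun o₂ =>
    match o₁, o₂ with
    | some a, some b => if a = b then .seq (.push .XR a) (.push .C true) else .skip
    | _, _ => .skip

/-- The register `C` serves as a continuation flag: the loop consumes its only bit, and another
round takes place only if the body pushes the bit back. The recursion therefore follows `unpair`. -/
theorem exec_splitCmd (x z t fl bad out : List Bool) (y : List Bool) : ∀ xr : List Bool,
    Exec splitCmd (vst y xr x z t [true] fl bad out)
      (vst (unpair y).2 ((unpair y).1.reverse ++ xr) x z t [] fl bad out) (5 * y.length + 6) := by
  induction y using unpair.induct with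
  | case1 b u ih =>
    intro xr
    refine Exec.mono (Exec.congr (Exec.loopCons (r := .C) (b := true) (l := []) rfl
      (s₁ := vst u (b :: xr) x z t [true] fl bad out) (B := 2 + 1 + 1)
      (.casePop (some b) rfl rfl (.casePop (some b) rfl rfl ?_)) (ih (b :: xr))) ?_) ?_
    · simp only [if_true]
      exact Exec.seq (.push rfl) (.push (by simp [vst]))
    · simp [unpair]
    · simp only [List.length_cons]; omega
  | case2 a b u h =>
    intro xr
    refine Exec.mono (Exec.congr (Exec.loopCons (r := .C) (b := true) (l := []) rfl
      (s₁ := vst u xr x z t [] fl bad out) (B := 1 + 1 + 1)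
      (.casePop (some a) rfl rfl (.casePop (some b) rfl rfl ?_)) (.loopNil rfl)) ?_) ?_
    · simp only [if_neg h]
      exact Exec.skip.congr (by simp [vst])
    · simp [unpair, h]
    · simp only [List.length_cons]; omega
  | case3 y h =>
    intro xr
    rcases y with _ | ⟨a, _ | ⟨b, u⟩⟩
    · refine Exec.mono (Exec.congr (Exec.loopCons (r := .C) (b := true) (l := []) rfl
        (s₁ := vst [] xr x z t [] fl bad out) (B := 1 + 1 + 1)
        (.casePop none rfl rfl (.casePop none rfl rfl (Exec.skip.congr ?_))) (.loopNil rfl)) ?_) ?_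
        <;> simp [vst, unpair]
    · refine Exec.mono (Exec.congr (Exec.loopCons (r := .C) (b := true) (l := []) rfl
        (s₁ := vst [] xr x z t [] fl bad out) (B := 1 + 1 + 1)
        (.casePop (some a) rfl rfl (.casePop none rfl rfl (Exec.skip.congr ?_))) (.loopNil rfl))
        ?_) ?_ <;> simp [vst, unpair]
    · exact absurd rfl (h a b u)

/-- Set a truth value register. -/
def setCmd (r : VReg) : Cmd VReg := .casePop r fun _ => .push r true

/-- Check one instruction. -/
def tokCmd : Bool → Option Bool → Option Bool → Cmd VReg
  | false, some false, some _ => .casePop .Z fun _ => .skip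
  | false, some true, some _ =>
    .seq (.casePop .FL fun o => if o = none then setCmd .BAD else .skip)
      (.seq (.clear .Z) (.copyTo .Y .Z .T))
  | true, some false, some b => .casePop .Z fun o => if o = some b then setCmd .FL else .skip
  | true, some true, some b => .casePop .Z fun o => if o = some b then .skip else setCmd .BAD
  | _, _, _ => .skip

/-- Check all instructions. -/
def checkCmd : Cmd VReg :=
  .loop .X fun b => .casePop .X fun o₁ => .casePop .X fun o₂ => tokCmd b o₁ o₂

theorem exec_set_FL (y xr x z t c bad out : List Bool) (b : Bool) :
    Exec (setCmd .FL) (vst y xr x z t c (flag b) bad out) (vst y xr x z t c (flag true) bad out)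
      2 := by
  refine .casePop _ rfl rfl (.push ?_)
  cases b <;> simp [vst, flag]

theorem exec_set_BAD (y xr x z t c fl out : List Bool) (b : Bool) :
    Exec (setCmd .BAD) (vst y xr x z t c fl (flag b) out) (vst y xr x z t c fl (flag true) out)
      2 := by
  refine .casePop _ rfl rfl (.push ?_)
  cases b <;> simp [vst, flag]

/-- `BAD` holds the negation of `ok`. The bound on `z` is an invariant that keeps the cost of
clearing `Z` linear in `y`, so that even a `sep`, which rewinds `Z` to a fresh copy of `Y`, takes
linear time. -/
theorem exec_checkCmd (y xr c out x : List Bool) : ∀ (z : List Bool) (fl ok : Bool),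
    z.length ≤ y.length → ∃ (z' : List Bool) (fl' : Bool), z'.length ≤ y.length ∧
    Exec checkCmd (vst y xr x z [] c (flag fl) (flag !ok) out)
      (vst y xr [] z' [] c (flag fl') (flag !(check y x z fl ok)) out)
      ((7 * y.length + 12) * (x.length + 1)) := by
  -- One round of the loop, shared by the four kinds of instruction: it consumes three bits and
  -- continues with the recursive call of `check`.
  have step : ∀ (b b₁ b₂ : Bool) (t z z₁ : List Bool) (fl fl₁ ok ok₁ : Bool),
      Exec (tokCmd b (some b₁) (some b₂)) (vst y xr t z [] c (flag fl) (flag !ok) out)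
        (vst y xr t z₁ [] c (flag fl₁) (flag !ok₁) out) (7 * y.length + 10) →
      check y (b :: b₁ :: b₂ :: t) z fl ok = check y t z₁ fl₁ ok₁ →
      (∃ (z' : List Bool) (fl' : Bool), z'.length ≤ y.length ∧
        Exec checkCmd (vst y xr t z₁ [] c (flag fl₁) (flag !ok₁) out)
          (vst y xr [] z' [] c (flag fl') (flag !(check y t z₁ fl₁ ok₁)) out)
          ((7 * y.length + 12) * (t.length + 1))) →
      ∃ (z' : List Bool) (fl' : Bool), z'.length ≤ y.length ∧
        Exec checkCmd (vst y xr (b :: b₁ :: b₂ :: t) z [] c (flag fl) (flag !ok) out)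
          (vst y xr [] z' [] c (flag fl') (flag !(check y (b :: b₁ :: b₂ :: t) z fl ok)) out)
          ((7 * y.length + 12) * ((b :: b₁ :: b₂ :: t).length + 1)) := by
    rintro b b₁ b₂ t z z₁ fl fl₁ ok ok₁ h hc ⟨z', fl', hz', h'⟩
    refine ⟨z', fl', hz', ?_⟩
    rw [hc]
    refine Exec.mono (Exec.loopCons (r := VReg.X) (b := b) (l := b₁ :: b₂ :: t) rfl
      (B := 7 * y.length + 10 + 1 + 1)
      (.casePop (some b₁) rfl rfl (.casePop (some b₂) rfl rfl ?_)) h') ?_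
    · simpa [vst] using h
    · simp only [List.length_cons]; nlinarith
  intro z fl ok hz
  induction x, z, fl, ok using check.induct (Y := y) with
  | case1 u t z fl ok ih =>
    refine step false false u t z z.tail fl fl ok ok ?_ (by rw [check]) (ih (by simp; omega))
    exact (Exec.casePop _ rfl (update_vst_Z ..) Exec.skip).mono (by omega)
  | case2 u t z fl ok ih =>
    refine step false true u t z y fl false ok (ok && fl) ?_ (by rw [check]) (ih le_rfl)
    have h1 : Exec (.casePop .FL fun o => if o = none then setCmd .BAD else .skip)
        (vst y xr t z [] c (flag fl) (flag !ok) out)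
        (vst y xr t z [] c (flag false) (flag !(ok && fl)) out) 3 := by
      refine .casePop _ rfl (update_vst_FL ..) ?_
      cases fl
      · have := exec_set_BAD y xr t z [] c (flag false) out (!ok)
        simpa [vst, flag] using this
      · simpa [vst, flag] using Exec.skip.mono (B' := 2) (by omega)
    have h2 := exec_clear VReg.Z (vst y xr t z [] c (flag false) (flag !(ok && fl)) out)
    have h3 := exec_copyTo (a := VReg.Y) (b := .Z) (t := .T) (by decide) (by decide) (by decide)
      (vst y xr t [] [] c (flag false) (flag !(ok && fl)) out) rfl
    simp only [update_vst_Z, vst, List.append_nil] at h2 h3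
    exact (h1.seq (h2.seq h3)).mono (by omega)
  | case3 b t z fl ok ih =>
    refine step true false b t z z.tail fl (fl || (z.head? == some b)) ok ok ?_ (by rw [check])
      (ih (by simp; omega))
    refine (Exec.casePop (B := 2) _ rfl (update_vst_Z ..) ?_).mono (by omega)
    by_cases h : z.head? = some b
    · simpa [vst, h] using exec_set_FL y xr t z.tail [] c (flag !ok) out fl
    · have h' : (z.head? == some b) = false := by simpa using h
      simp only [vst, h, h', if_false, Bool.or_false]
      exact Exec.skip.mono (by omega)
  | case4 b t z fl ok ih =>
    refine step true true b t z z.tail fl fl ok (ok && (z.head? == some b)) ?_ (by rw [check])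
      (ih (by simp; omega))
    refine (Exec.casePop (B := 2) _ rfl (update_vst_Z ..) ?_).mono (by omega)
    by_cases h : z.head? = some b
    · simpa [vst, h] using Exec.skip.mono (B' := 2) (by omega)
    · have h' : (z.head? == some b) = false := by simpa using h
      simpa [vst, h, h'] using exec_set_BAD y xr t z.tail [] c (flag fl) out (!ok)
  | case5 z fl ok =>
    exact ⟨z, fl, hz, (Exec.loopNil rfl).mono (by simp)⟩
  | case6 a z fl ok =>
    rw [show check y [a] z fl ok = ok by cases a <;> rw [check]]
    refine ⟨z, fl, hz, Exec.mono (Exec.loopCons (r := VReg.X) (b := a) (l := []) rfl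
      (B := 1 + 1 + 1) (s₁ := vst y xr [] z [] c (flag fl) (flag !ok) out)
      (.casePop none rfl rfl (.casePop none rfl rfl ?_)) (.loopNil rfl)) ?_⟩
    · cases a <;> exact Exec.skip.congr (by simp)
    · simp only [List.length_cons]; nlinarith
  | case7 a b z fl ok =>
    rw [show check y [a, b] z fl ok = ok by cases a <;> cases b <;> rw [check]]
    refine ⟨z, fl, hz, Exec.mono (Exec.loopCons (r := VReg.X) (b := a) (l := [b]) rfl
      (B := 1 + 1 + 1) (s₁ := vst y xr [] z [] c (flag fl) (flag !ok) out)
      (.casePop (some b) rfl rfl (.casePop none rfl rfl ?_)) (.loopNil rfl)) ?_⟩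
    · cases a <;> cases b <;> exact Exec.skip.congr (by simp)
    · simp only [List.length_cons]; nlinarith

/-- The program of the verifier. -/
def verifyCmd : Cmd VReg :=
  .seq (.push .C true) <| .seq splitCmd <| .seq (.moveRev .XR .X) <| .seq (.copyTo .Y .Z .T) <|
  .seq (.push .FL true) <| .seq checkCmd <| .seq (.clear .Y) <| .seq (.clear .Z) <|
  .seq (.clear .FL) <|
  .casePop .BAD fun o => .push .OUT (o = none)

theorem single_VReg_Y (x : List Bool) : single VReg.Y x = vst x [] [] [] [] [] [] [] [] := by
  funext r; cases r <;> rfl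

theorem single_VReg_OUT (x : List Bool) : single VReg.OUT x = vst [] [] [] [] [] [] [] [] x := by
  funext r; cases r <;> rfl

theorem exec_verifyCmd (z : List Bool) : Exec verifyCmd (single .Y z) (single .OUT [verify z])
    ((7 * z.length + 12) * (z.length + 1) + 20 * z.length + 30) := by
  rw [single_VReg_Y, single_VReg_OUT]
  have hl := unpair_length z
  obtain ⟨z', fl', hz', hc⟩ := exec_checkCmd (unpair z).2 [] [] [] (unpair z).1 (unpair z).2
    true true le_rfl
  have h1 : Exec (.push .C true) (vst z [] [] [] [] [] [] [] []) (vst z [] [] [] [] [true] [] [] [])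
    1 := .push (by simp [vst])
  have h2 := exec_splitCmd [] [] [] [] [] [] z []
  have h3 := exec_moveRev (a := VReg.XR) (b := .X) (by decide)
    (vst (unpair z).2 ((unpair z).1.reverse ++ []) [] [] [] [] [] [] [])
  have h4 := exec_copyTo (a := VReg.Y) (b := .Z) (t := .T) (by decide) (by decide) (by decide)
    (vst (unpair z).2 [] (unpair z).1 [] [] [] [] [] []) rfl
  have h5 : Exec (.push .FL true) (vst (unpair z).2 [] (unpair z).1 (unpair z).2 [] [] [] [] [])
    (vst (unpair z).2 [] (unpair z).1 (unpair z).2 [] [] [true] [] []) 1 := .push (by simp [vst])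
  have h6 := exec_clear VReg.Y (vst (unpair z).2 [] [] z' [] [] (flag fl') (flag !(verify z)) [])
  have h7 := exec_clear VReg.Z (vst [] [] [] z' [] [] (flag fl') (flag !(verify z)) [])
  have h8 := exec_clear VReg.FL (vst [] [] [] [] [] [] (flag fl') (flag !(verify z)) [])
  have h9 : Exec (.casePop .BAD fun o => .push .OUT (o = none))
      (vst [] [] [] [] [] [] [] (flag !(verify z)) [])
      (vst [] [] [] [] [] [] [] [] [verify z]) 2 := by
    refine .casePop _ rfl rfl (.push ?_)
    cases verify z <;> simp [vst, flag]
  simp only [update_vst_X, update_vst_XR, update_vst_Y, update_vst_Z, update_vst_FL, vst,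
    List.append_nil, List.reverse_reverse] at h2 h3 h4 h6 h7 h8
  refine (h1.seq (h2.seq (h3.seq (h4.seq (h5.seq (hc.seq (h6.seq (h7.seq (h8.seq h9))))))))).mono ?_
  have e : (flag fl').length ≤ 1 := by cases fl' <;> simp [flag]
  have e2 : (7 * (unpair z).2.length + 12) * ((unpair z).1.length + 1) ≤
    (7 * z.length + 12) * (z.length + 1) := Nat.mul_le_mul (by omega) (by omega)
  simp only [List.length_reverse]
  omega

theorem verify_mem_classP : {z | verify z = true} ∈ classP := by
  refine ⟨verify, ?_, fun x => Iff.rfl⟩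
  -- The one-bit list is the encoding of the truth value, so the program is composed with the
  -- identity machine on encoded truth values.
  refine ProgComputable.compose (f := fun z => [verify z]) (h := verify) ?_
    ⟨idComputableInPolyTime Computability.encodeBool⟩ (fun x => rfl)
  refine ⟨VReg, inferInstance, inferInstance, verifyCmd, .Y, .OUT,
    (7 * Polynomial.X + 12) * (Polynomial.X + 1) + 20 * Polynomial.X + 30, fun x => ?_⟩
  simpa [Exec] using exec_verifyCmd x

theorem clauseSat_mem_classNP : clauseSat ∈ classNP := by
  refine ⟨_, verify_mem_classP, Polynomial.X, fun x => ?_⟩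
  simp only [Polynomial.eval_X]
  refine exists_congr fun y => and_congr_right fun _ => ?_
  change _ ↔ verify (pair x y) = true
  rw [verify, unpair_pair]

end RobustlyOften

/-! ### Bit clause formulas that describe runs of shift registers -/

namespace RobustlyOften

/-- Partially specified bit strings. -/
abbrev Pat := List (Option Bool)

/-- All specified bits agree. -/
def matchAll : Pat → List Bool → Bool
  | [], _ => true
  | none :: p, Z => matchAll p Z.tail
  | some b :: p, Z => (Z.head? == some b) && matchAll p Z.tail

/-- Some specified bit agrees. -/
def matchAny : Pat → List Bool → Bool
  | [], _ => false
  | none :: p, Z => matchAny p Z.tail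
  | some b :: p, Z => (Z.head? == some b) || matchAny p Z.tail

/-- The instruction that demands agreement. -/
def reqTok : Option Bool → Tok
  | none => .star
  | some b => .req b

/-- The instruction for a literal. -/
def litTok : Option Bool → Tok
  | none => .star
  | some b => .lit b

/-- Encoding of lists of instructions. -/
def encode (ts : List Tok) : List Bool := ts.flatMap Tok.bits

theorem encode_append (s t : List Tok) : encode (s ++ t) = encode s ++ encode t := by
  simp [encode]

theorem encode_cons (s : Tok) (t : List Tok) : encode (s :: t) = s.bits ++ encode t := rfl

theorem check_reqs (Y : List Bool) (p : Pat) : ∀ (t Z : List Bool) (fl ok : Bool),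
    check Y (encode (p.map reqTok) ++ t) Z fl ok =
      check Y t (Z.drop p.length) fl (ok && matchAll p Z) := by
  induction p with
  | nil => intro t Z fl ok; simp [encode, matchAll]
  | cons o p ih =>
    intro t Z fl ok
    cases o <;>
      simp [encode_cons, reqTok, Tok.bits, check, ih, matchAll, Bool.and_assoc]

theorem check_lits (Y : List Bool) (p : Pat) : ∀ (t Z : List Bool) (fl ok : Bool),
    check Y (encode (p.map litTok) ++ t) Z fl ok =
      check Y t (Z.drop p.length) (fl || matchAny p Z) ok := by
  induction p with
  | nil => intro t Z fl ok; simp [encode, matchAny]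
  | cons o p ih =>
    intro t Z fl ok
    cases o <;>
      simp [encode_cons, litTok, Tok.bits, check, ih, matchAny, Bool.or_assoc]

/-- The instructions for a list of clauses. -/
def clauseToks (cs : List Pat) : List Tok := cs.flatMap fun p => p.map litTok ++ [.sep]

/-- Every `sep` rewinds to `Y` and lowers the flag, so each clause is evaluated from the same
starting situation. -/
theorem check_clauses (Y : List Bool) (cs : List Pat) : ∀ ok : Bool,
    check Y (encode (clauseToks cs)) Y false ok = (ok && cs.all fun p => matchAny p Y) := by
  induction cs with
  | nil => intro ok; simp [clauseToks, encode, check]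
  | cons p cs ih =>
    intro ok
    have : clauseToks (p :: cs) = p.map litTok ++ .sep :: clauseToks cs := by simp [clauseToks]
    rw [this, encode_append, check_lits, encode_cons]
    simp [Tok.bits, check, ih, Bool.and_assoc]

/-- The formula with one conjunctive pattern and a list of clauses. -/
def formula (I : Pat) (cs : List Pat) : List Bool :=
  encode (I.map reqTok ++ .sep :: clauseToks cs)

/-- The flag is initially true, so the `sep` after the conjunctive pattern demands nothing; it only
rewinds and lowers the flag for the first clause. -/
theorem check_formula (Y : List Bool) (I : Pat) (cs : List Pat) :
    check Y (formula I cs) Y true true = (matchAll I Y && cs.all fun p => matchAny p Y) := by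
  rw [formula, encode_append, check_reqs, encode_cons]
  simp [Tok.bits, check, check_clauses]

theorem matchAll_append (p q : Pat) : ∀ Z : List Bool,
    matchAll (p ++ q) Z = (matchAll p Z && matchAll q (Z.drop p.length)) := by
  induction p with
  | nil => intro Z; simp [matchAll]
  | cons o p ih => intro Z; cases o <;> simp [matchAll, ih, Bool.and_assoc]

theorem matchAny_append (p q : Pat) : ∀ Z : List Bool,
    matchAny (p ++ q) Z = (matchAny p Z || matchAny q (Z.drop p.length)) := by
  induction p with
  | nil => intro Z; simp [matchAny]
  | cons o p ih => intro Z; cases o <;> simp [matchAny, ih, Bool.or_assoc]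

theorem matchAll_replicate (n : ℕ) : ∀ Z : List Bool, matchAll (List.replicate n none) Z = true := by
  induction n with
  | zero => intro Z; rfl
  | succ n ih => intro Z; exact ih _

theorem matchAny_replicate (n : ℕ) : ∀ Z : List Bool,
    matchAny (List.replicate n none) Z = false := by
  induction n with
  | zero => intro Z; rfl
  | succ n ih => intro Z; exact ih _

theorem matchAll_some (v : List Bool) : ∀ Z : List Bool,
    matchAll (v.map some) Z = true ↔ v <+: Z := by
  induction v with
  | nil => intro Z; simp [matchAll]
  | cons b v ih =>
    intro Z
    cases Z with
    | nil => simp [matchAll]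
    | cons a Z => cases a <;> cases b <;> simp [matchAll, ih, List.cons_prefix_cons]

/-- The disjunction of the negated bits fails exactly when all bits agree. The length hypothesis is
needed because a position beyond the end of `Z` also falsifies its literal. -/
theorem matchAny_not (v : List Bool) : ∀ Z : List Bool, v.length ≤ Z.length →
    (matchAny (v.map fun b => some !b) Z = false ↔ v <+: Z) := by
  induction v with
  | nil => intro Z _; simp [matchAny]
  | cons b v ih =>
    intro Z hZ
    cases Z with
    | nil => simp at hZ
    | cons a Z =>
      have h := ih Z (by simpa using hZ)
      simp only [List.map_cons, matchAny, List.head?_cons, Bool.or_eq_false_iff, List.tail_cons, h,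
        List.cons_prefix_cons]
      refine and_congr_left fun _ => ?_
      cases a <;> cases b <;> decide

theorem matchAny_bit (r : ℕ) (o : Option Bool) (Z : List Bool) (b : Bool) (ho : o = some b) :
    matchAny (List.replicate r none ++ [o]) Z = true ↔ Z[r]? = some b := by
  subst ho
  rw [matchAny_append, matchAny_replicate, Bool.false_or, List.length_replicate]
  simp only [matchAny, Bool.or_false, List.head?_drop, beq_iff_eq]

theorem matchAll_prefix (p : Pat) : ∀ (e Z : List Bool), p.length ≤ e.length → e <+: Z →
    matchAll p Z = matchAll p e := by
  induction p with
  | nil => intro e Z _ _; rfl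
  | cons o p ih =>
    intro e Z he h
    cases e with
    | nil => simp at he
    | cons a e =>
      cases Z with
      | nil => simp at h
      | cons b Z =>
        rw [List.cons_prefix_cons] at h
        obtain ⟨rfl, h⟩ := h
        have := ih e Z (by simpa using he) h
        cases o <;> simp [matchAll, this]

theorem append_prefix_iff (u v Z : List Bool) :
    u ++ v <+: Z ↔ u <+: Z ∧ v <+: Z.drop u.length := by
  constructor
  · rintro ⟨t, rfl⟩
    exact ⟨⟨v ++ t, by simp⟩, ⟨t, by simp⟩⟩
  · rintro ⟨⟨t, rfl⟩, h⟩
    rw [List.drop_left] at h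
    exact (List.prefix_append_right_inj u).mpr h

theorem flatten_drop {α : Type} {w : ℕ} (L : List (List α)) : (∀ l ∈ L, l.length = w) →
    ∀ (i : ℕ) (l : List α), L[i]? = some l → l <+: L.flatten.drop (i * w) := by
  induction L with
  | nil => intro _ i l h; simp at h
  | cons a L ih =>
    intro hL i l h
    cases i with
    | zero => simp at h; subst h; simp
    | succ i =>
      have h1 : a.length = w := hL a (by simp)
      have := ih (fun l hl => hL l (by simp [hl])) i l (by simpa using h)
      rwa [List.flatten_cons, Nat.succ_mul, Nat.add_comm, ← List.drop_drop, ← h1, List.drop_left, h1]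

theorem flatten_length {α : Type} {w : ℕ} (L : List (List α)) (hL : ∀ l ∈ L, l.length = w) :
    L.flatten.length = L.length * w := by
  rw [List.length_flatten, List.map_congr_left hL]
  simp

theorem matchAll_flatten {w : ℕ} (L : List Pat) : (∀ l ∈ L, l.length = w) → ∀ Z : List Bool,
    (matchAll L.flatten Z = true ↔
      ∀ (i : ℕ) (p : Pat), L[i]? = some p → matchAll p (Z.drop (i * w)) = true) := by
  induction L with
  | nil => intro _ Z; simp [matchAll]
  | cons a L ih =>
    intro hL Z
    have h1 : a.length = w := hL a (by simp)
    rw [List.flatten_cons, matchAll_append, Bool.and_eq_true, ih (fun l hl => hL l (by simp [hl]))]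
    constructor
    · rintro ⟨h, h'⟩ i p hp
      cases i with
      | zero => simp at hp; subst hp; simpa using h
      | succ i =>
        have := h' i p (by simpa using hp)
        rwa [List.drop_drop, h1, Nat.add_comm, ← Nat.succ_mul] at this
    · intro h
      refine ⟨by simpa using h 0 a (by simp), fun i p hp => ?_⟩
      rw [List.drop_drop, h1, Nat.add_comm, ← Nat.succ_mul]
      exact h (i + 1) p (by simpa using hp)

/-! ### Local rules of a shift register as translated clauses -/

section Register

variable {A : Type} [Fintype A] (enc : A → List Bool) (w : ℕ) (F : A → A → A → A → A)

/-- The clauses that describe one step of the register, in two parts that are separated by a gap. -/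
noncomputable def stepPats : List (Pat × Pat) :=
  (Finset.univ : Finset (A × A × A × A)).toList.flatMap fun x => (List.range w).map fun r =>
    ((enc x.1 ++ enc x.2.1 ++ enc x.2.2.1).map (fun b => some !b),
      (enc x.2.2.2).map (fun b => some !b) ++
        (List.replicate r none ++ [(enc (F x.1 x.2.1 x.2.2.1 x.2.2.2))[r]?]))

/-- The clauses of the `i`-th step. -/
def clausesAt (w g : ℕ) (tp : List (Pat × Pat)) (i : ℕ) : List Pat :=
  tp.map fun x => List.replicate (i * w) none ++ x.1 ++ List.replicate (g * w) none ++ x.2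

/-- The clauses of all steps. -/
def allClauses (w g U : ℕ) (tp : List (Pat × Pat)) : List Pat :=
  (List.range U).flatMap (clausesAt w g tp)

/-- The conjunctive pattern with the initial cells and the final cell. -/
def framePat (w V : ℕ) (init : List Pat) (fin : List Bool) : Pat :=
  init.flatten ++ List.replicate (V * w) none ++ fin.map some

variable {enc w F}

/-- A clause is an implication: the negated codes of `a, b, c, l` fail together only if these four
cells are present, and then the remaining literal fixes bit `r` of the new cell. Letting `r` range
below `w` fixes the whole cell. -/
theorem stepPats_sat_iff (hw : ∀ a, (enc a).length = w) (g i : ℕ) (Y : List Bool)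
    (hY : (i + g + 5) * w ≤ Y.length) :
    (∀ p ∈ clausesAt w g (stepPats enc w F) i, matchAny p Y = true) ↔
      ∀ a b c l, enc a <+: Y.drop (i * w) → enc b <+: Y.drop ((i + 1) * w) →
        enc c <+: Y.drop ((i + 2) * w) → enc l <+: Y.drop ((i + g + 3) * w) →
        enc (F a b c l) <+: Y.drop ((i + g + 4) * w) := by
  have e1 : (i + g + 5) * w = i * w + g * w + 5 * w := by ring
  have key : ∀ (a b c l : A) (r : ℕ), r < w →
      (matchAny (List.replicate (i * w) none ++ (enc a ++ enc b ++ enc c).map (fun b => some !b) ++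
        List.replicate (g * w) none ++ ((enc l).map (fun b => some !b) ++
        (List.replicate r none ++ [(enc (F a b c l))[r]?]))) Y = true ↔
      (enc a <+: Y.drop (i * w) → enc b <+: Y.drop ((i + 1) * w) →
        enc c <+: Y.drop ((i + 2) * w) → enc l <+: Y.drop ((i + g + 3) * w) →
        (Y.drop ((i + g + 4) * w))[r]? = (enc (F a b c l))[r]?)) := by
    intro a b c l r hr
    have hr' : r < (enc (F a b c l)).length := by rw [hw]; exact hr
    have ho : (enc (F a b c l))[r]? = some ((enc (F a b c l))[r]) := List.getElem?_eq_getElem hr'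
    simp only [matchAny_append (List.replicate (i * w) none ++ _ ++ _),
      matchAny_append (List.replicate (i * w) none ++ _),
      matchAny_append (List.replicate (i * w) none),
      matchAny_append (List.map _ (enc l)), matchAny_replicate, Bool.or_eq_true]
    rw [matchAny_bit r _ _ _ ho]
    have h1 := matchAny_not (enc a ++ enc b ++ enc c) (Y.drop (i * w))
      (by simp [hw]; omega)
    have h2 := matchAny_not (enc l) (Y.drop ((i + g + 3) * w))
      (by simp [hw]; rw [show (i + g + 3) * w = i * w + g * w + 3 * w by ring]; omega)
    rw [append_prefix_iff, append_prefix_iff] at h1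
    simp only [List.length_append, List.length_map, List.length_replicate, hw, List.drop_drop]
      at h1 ⊢
    rw [show i * w + w = (i + 1) * w by ring, show i * w + (w + w) = (i + 2) * w by ring] at h1
    rw [show i * w + (w + w + w) + g * w = (i + g + 3) * w by ring,
      show (i + g + 3) * w + w = (i + g + 4) * w by ring, ← ho]
    by_cases k1 : matchAny ((enc a ++ enc b ++ enc c).map fun b => some !b) (Y.drop (i * w)) = false
    · by_cases k2 : matchAny ((enc l).map fun b => some !b) (Y.drop ((i + g + 3) * w)) = false
      · have k3 := h1.1 k1
        have k4 := h2.1 k2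
        simp only [k1, k2, k3.1.1, k3.1.2, k3.2, k4, Bool.false_eq_true, false_or, forall_const]
      · have k4 := fun h => k2 (h2.2 h)
        rw [Bool.not_eq_false] at k2
        simp only [k2, true_or, or_true, true_iff]
        exact fun _ _ _ h => absurd h k4
    · have k3 := fun h => k1 (h1.2 h)
      rw [Bool.not_eq_false] at k1
      simp only [k1, true_or, or_true, true_iff]
      intro ha hb hc
      exact absurd ⟨⟨ha, hb⟩, hc⟩ k3
  constructor
  -- The prefix is recovered bit by bit from the clauses with the same `a, b, c, l`.
  · intro h a b c l ha hb hc hl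
    rw [List.prefix_iff_eq_take, hw]
    apply List.ext_getElem?
    intro r
    by_cases hr : r < w
    · rw [List.getElem?_take_of_lt hr]
      refine ((key a b c l r hr).1 (h _ ?_) ha hb hc hl).symm
      have hm : ((enc a ++ enc b ++ enc c).map (fun b => some !b),
          (enc l).map (fun b => some !b) ++ (List.replicate r none ++ [(enc (F a b c l))[r]?])) ∈
          stepPats enc w F := 
        List.mem_flatMap.2 ⟨(a, b, c, l), by simp,
          List.mem_map.2 ⟨r, List.mem_range.2 hr, rfl⟩⟩
      exact List.mem_map.2 ⟨_, hm, rfl⟩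
    · rw [List.getElem?_eq_none (by rw [hw]; omega), List.getElem?_eq_none (by
        rw [List.length_take]; omega)]
  · intro h p hp
    rw [clausesAt, List.mem_map] at hp
    obtain ⟨x, hx, rfl⟩ := hp
    rw [stepPats, List.mem_flatMap] at hx
    obtain ⟨⟨a, b, c, l⟩, -, hx⟩ := hx
    obtain ⟨r, hr, rfl⟩ := List.mem_map.1 hx
    have hr : r < w := by simpa using hr
    refine (key a b c l r hr).2 fun ha hb hc hl => ?_
    obtain ⟨t, ht⟩ := h a b c l ha hb hc hl
    rw [← ht, List.getElem?_append_left (by rw [hw]; exact hr)]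

/-- Satisfying strings and register runs with the prescribed ends correspond by cutting a string
into blocks of width `w`. Validity has to be demanded of the initial blocks only, since the clauses
propagate it. The bound `hB` makes the length restriction on satisfying strings harmless. -/
theorem register_sat_iff (hw : ∀ a, (enc a).length = w) (hinj : Function.Injective enc)
    (g V : ℕ) (init : List Pat) (fin : A) (hlen : init.length = g + 4)
    (hinit : ∀ p ∈ init, p.length = w ∧
      ∀ Z : List Bool, w ≤ Z.length → matchAll p Z = true → ∃ a, enc a <+: Z) (B : ℕ)
    (hB : (g + V + 5) * w ≤ B) :
    (∃ Y : List Bool, Y.length ≤ B ∧ (matchAll (framePat w V init (enc fin)) Y &&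
        (allClauses w g (V + 1) (stepPats enc w F)).all fun p => matchAny p Y) = true) ↔
      ∃ v : ℕ → A, (∀ i p, init[i]? = some p → matchAll p (enc (v i)) = true) ∧
        (∀ i ≤ V, v (i + g + 4) = F (v i) (v (i + 1)) (v (i + 2)) (v (i + g + 3))) ∧
        v (g + V + 4) = fin := by
  have hl : ∀ p ∈ init, p.length = w := fun p hp => (hinit p hp).1
  have hpre : ∀ (a b : A) (Z : List Bool), enc a <+: Z → enc b <+: Z → a = b := by
    intro a b Z ha hb
    refine hinj ((List.prefix_of_prefix_length_le ha hb ?_).eq_of_length ?_) <;> simp [hw]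
  have hframe : ∀ Y, matchAll (framePat w V init (enc fin)) Y = true ↔
      (∀ (i : ℕ) (p : Pat), init[i]? = some p → matchAll p (Y.drop (i * w)) = true) ∧
        enc fin <+: Y.drop ((g + V + 4) * w) := by
    intro Y
    rw [framePat, matchAll_append, matchAll_append, matchAll_replicate, Bool.and_true,
      Bool.and_eq_true, matchAll_flatten init hl, matchAll_some, List.length_append,
      flatten_length init hl, hlen, List.length_replicate, ← Nat.add_mul]
    rw [show g + 4 + V = g + V + 4 by ring]
  have hcl : ∀ Y : List Bool, (g + V + 5) * w ≤ Y.length →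
      (((allClauses w g (V + 1) (stepPats enc w F)).all fun p => matchAny p Y) = true ↔
      ∀ i ≤ V, ∀ a b c l, enc a <+: Y.drop (i * w) → enc b <+: Y.drop ((i + 1) * w) →
        enc c <+: Y.drop ((i + 2) * w) → enc l <+: Y.drop ((i + g + 3) * w) →
        enc (F a b c l) <+: Y.drop ((i + g + 4) * w)) := by
    intro Y hY
    rw [List.all_eq_true]
    simp only [allClauses, List.mem_flatMap, List.mem_range]
    have : ∀ i ≤ V, (i + g + 5) * w ≤ Y.length := fun i hi =>
      (Nat.mul_le_mul_right w (by omega)).trans hY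
    constructor
    · intro h i hi
      exact (stepPats_sat_iff hw g i Y (this i hi)).1 fun p hp => h p ⟨i, by omega, hp⟩
    · rintro h p ⟨i, hi, hp⟩
      exact (stepPats_sat_iff hw g i Y (this i (by omega))).2 (h i (by omega)) p hp
  constructor
  · rintro ⟨Y, -, hY⟩
    rw [Bool.and_eq_true, hframe] at hY
    obtain ⟨⟨h1, h2⟩, h3⟩ := hY
    -- The final cell stands at the last block, which forces `Y` to be long enough. For `w = 0`
    -- truncated subtraction gives no information, but then the bound is trivial.
    have hY : (g + V + 5) * w ≤ Y.length ∨ w = 0 := by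
      have := h2.length_le
      rw [hw, List.length_drop] at this
      rcases Nat.eq_zero_or_pos w with h | h
      · exact Or.inr h
      · left
        rw [show (g + V + 5) * w = (g + V + 4) * w + w by ring]
        omega
    have hY : (g + V + 5) * w ≤ Y.length := by
      rcases hY with h | h
      · exact h
      · rw [h]; simp
    rw [hcl Y hY] at h3
    -- Every block encodes a cell: the first `g + 4` by the initial patterns, each later one by the
    -- clauses applied to earlier blocks.
    have hex : ∀ i, i < g + V + 5 → ∃ a, enc a <+: Y.drop (i * w) := by
      intro i
      induction i using Nat.strong_induction_on with
      | _ i ih =>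
        intro hi
        by_cases hi' : i < g + 4
        · have hp : init[i]? = some (init[i]'(by omega)) := List.getElem?_eq_getElem _
          refine (hinit _ (List.getElem_mem _)).2 _ ?_ (h1 i _ hp)
          rw [List.length_drop]
          have : (i + 1) * w ≤ (g + V + 5) * w := Nat.mul_le_mul_right w (by omega)
          rw [Nat.add_mul] at this
          omega
        · obtain ⟨j, rfl⟩ : ∃ j, i = j + g + 4 := ⟨i - (g + 4), by omega⟩
          obtain ⟨a, ha⟩ := ih j (by omega) (by omega)
          obtain ⟨b, hb⟩ := ih (j + 1) (by omega) (by omega)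
          obtain ⟨c, hc⟩ := ih (j + 2) (by omega) (by omega)
          obtain ⟨l, hl⟩ := ih (j + g + 3) (by omega) (by omega)
          exact ⟨_, h3 j (by omega) a b c l ha hb hc hl⟩
    have : ∀ i, ∃ a, i < g + V + 5 → enc a <+: Y.drop (i * w) := by
      intro i
      by_cases hi : i < g + V + 5
      · obtain ⟨a, ha⟩ := hex i hi
        exact ⟨a, fun _ => ha⟩
      · exact ⟨fin, fun h => absurd h hi⟩
    choose v hv using this
    refine ⟨v, fun i p hp => ?_, fun i hi => ?_, ?_⟩
    · have hi : i < g + 4 := by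
        rw [← hlen]
        exact (List.getElem?_eq_some_iff.1 hp).1
      have := h1 i p hp
      rwa [matchAll_prefix p (enc (v i)) _ _ (hv i (by omega))] at this
      rw [hw, hl p (List.mem_of_getElem? hp)]
    · exact hpre _ _ _ (hv _ (by omega)) (h3 i hi _ _ _ _ (hv _ (by omega)) (hv _ (by omega))
        (hv _ (by omega)) (hv _ (by omega)))
    · exact hpre _ _ _ (hv _ (by omega)) h2
  · rintro ⟨v, h1, h2, h3⟩
    -- The satisfying string is the concatenation of the codes of the register values.
    set L := (List.range (g + V + 5)).map fun i => enc (v i) with hL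
    have hLw : ∀ l ∈ L, l.length = w := by
      intro l hl
      obtain ⟨i, -, rfl⟩ := List.mem_map.1 hl
      exact hw _
    have hlenL : L.flatten.length = (g + V + 5) * w := by
      rw [flatten_length L hLw, hL]; simp
    have hcell : ∀ i, i < g + V + 5 → enc (v i) <+: L.flatten.drop (i * w) := by
      intro i hi
      exact flatten_drop L hLw i _ (by simp [hL, hi])
    refine ⟨L.flatten, by omega, ?_⟩
    rw [Bool.and_eq_true, hframe, hcl _ hlenL.ge]
    refine ⟨⟨fun i p hp => ?_, ?_⟩, fun i hi a b c l ha hb hc hl => ?_⟩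
    · have hi : i < g + 4 := by
        rw [← hlen]
        exact (List.getElem?_eq_some_iff.1 hp).1
      rw [matchAll_prefix p (enc (v i)) _ _ (hcell i (by omega))]
      · exact h1 i p hp
      · rw [hw, hl p (List.mem_of_getElem? hp)]
    · rw [← h3]
      exact hcell _ (by omega)
    · rw [hpre _ _ _ ha (hcell _ (by omega)), hpre _ _ _ hb (hcell _ (by omega)),
        hpre _ _ _ hc (hcell _ (by omega)), hpre _ _ _ hl (hcell _ (by omega)), ← h2 i hi]
      exact hcell _ (by omega)

end Register

end RobustlyOften

/-! ### Multi-stack machines as shift registers -/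

namespace RobustlyOften

open Function

/-- The first `g + 4` values are free and all later ones are forced, by well-founded recursion. -/
theorem exists_register {A : Type} (F : A → A → A → A → A) (u : ℕ → A) (g : ℕ) :
    ∃ v : ℕ → A, (∀ i < g + 4, v i = u i) ∧
      ∀ i, v (i + g + 4) = F (v i) (v (i + 1)) (v (i + 2)) (v (i + g + 3)) := by
  let G : (n : ℕ) → ((m : ℕ) → m < n → A) → A := fun n rec =>
    if h : g + 4 ≤ n then
      F (rec (n - (g + 4)) (by omega)) (rec (n - (g + 4) + 1) (by omega))
        (rec (n - (g + 4) + 2) (by omega)) (rec (n - 1) (by omega))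
    else u n
  let v : ℕ → A := WellFounded.fix Nat.lt_wfRel.wf G
  have hv : ∀ n, v n = G n fun m _ => v m := fun n => WellFounded.fix_eq _ _ _
  refine ⟨v, fun i hi => ?_, fun i => ?_⟩
  · rw [hv]; exact dif_neg (by omega)
  · rw [hv]
    refine (dif_pos (show g + 4 ≤ i + g + 4 by omega)).trans ?_
    have e : i + g + 4 - (g + 4) = i := by omega
    have e' : i + g + 4 - 1 = i + g + 3 := by omega
    simp only [e, e']

section Machine

variable {K : Type} [DecidableEq K] {Γ : K → Type} {Q : Type}

/-- Stack actions: nothing, or a pop or a push on one stack. -/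
abbrev Act (Γ : K → Type) : Type := Option (Σ k, Option (Γ k))

/-- Effect of an action on the stacks. -/
def Act.apply : Act Γ → (∀ k, List (Γ k)) → ∀ k, List (Γ k)
  | none, S => S
  | some ⟨k, none⟩, S => update S k (S k).tail
  | some ⟨k, some g⟩, S => update S k (g :: S k)

/-- One step of a multi-stack machine with transition function `δ`. -/
def mstep (δ : Q → (∀ k, Option (Γ k)) → Q × Act Γ) (c : Q × ∀ k, List (Γ k)) :
    Q × ∀ k, List (Γ k) :=
  ((δ c.1 fun k => (c.2 k).head?).1, (δ c.1 fun k => (c.2 k).head?).2.apply c.2)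

theorem length_apply_le (a : Act Γ) (S : ∀ k, List (Γ k)) (k : K) :
    (a.apply S k).length ≤ (S k).length + 1 := by
  rcases a with _ | ⟨j, _ | g⟩
  · simp [Act.apply]
  · by_cases h : k = j
    · subst h; simp [Act.apply]; omega
    · simp [Act.apply, h]
  · by_cases h : k = j
    · subst h; simp [Act.apply]
    · simp [Act.apply, h]

theorem length_mstep_le (δ : Q → (∀ k, Option (Γ k)) → Q × Act Γ) (c : Q × ∀ k, List (Γ k))
    (t : ℕ) (k : K) : (((mstep δ)^[t] c).2 k).length ≤ (c.2 k).length + t := by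
  induction t with
  | zero => simp
  | succ t ih =>
    rw [iterate_succ_apply']
    exact (length_apply_le _ _ k).trans (by omega)

/-- Cells of the register that simulates a multi-stack machine: the head of a row, with the state
(or `none` in the initial row), and a level of the stacks, with two bits that hold the input in the
initial row. All of them carry the action that led to the row; it is `none` in the first row after
the initial one, which loads the input. -/
abbrev Cell (Q : Type) (Γ : K → Type) : Type :=
  (Option Q × Option (Act Γ)) ⊕ ((∀ k, Option (Γ k)) × Option (Act Γ) × (Bool × Bool))

/-- The symbols in a cell. -/
def Cell.conts : Cell Q Γ → ∀ k, Option (Γ k)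
  | .inl _ => fun _ => none
  | .inr c => c.1

/-- The action in a cell. -/
def Cell.act : Cell Q Γ → Option (Act Γ)
  | .inl c => c.2
  | .inr c => c.2.1

/-- The level above a cell is empty. -/
def Cell.blocked (k₀ : K) : Cell Q Γ → Bool
  | .inl _ => false
  | .inr c => (c.1 k₀).isNone

/-- The symbols of the next row, from an action and the neighbouring cells. -/
def nextConts (k₀ : K) (sym : Bool → Γ k₀) (a c l : Cell Q Γ) (cont : ∀ k, Option (Γ k))
    (raw : Bool × Bool) : Option (Act Γ) → ∀ k, Option (Γ k)
  | none => update (fun _ => none) k₀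
      (if l.blocked k₀ then none else if raw.1 then some (sym raw.2) else none)
  | some none => cont
  | some (some ⟨k, none⟩) => update cont k (c.conts k)
  | some (some ⟨k, some g⟩) => update cont k (match a with
      | .inl _ => some g
      | .inr ca => ca.1 k)

/-- The update function of the register. -/
def cellStep (δ : Q → (∀ k, Option (Γ k)) → Q × Act Γ) (q₀ : Q) (k₀ : K) (sym : Bool → Γ k₀)
    (a b c l : Cell Q Γ) : Cell Q Γ :=
  match b with
  | .inl (none, _) => .inl (some q₀, none)
  | .inl (some q, _) => .inl (some (δ q c.conts).1, some (δ q c.conts).2)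
  | .inr (cont, _, raw) => .inr (nextConts k₀ sym a c l cont raw l.act, l.act, (false, false))

/-- The row that describes a configuration. -/
def rowCell (q : Q) (act : Option (Act Γ)) (S : ∀ k, List (Γ k)) : ℕ → Cell Q Γ
  | 0 => .inl (some q, act)
  | j + 1 => .inr (fun k => (S k)[j]?, act, (false, false))

/-- The initial row. -/
def rawCell (L : List (Bool × Bool)) : ℕ → Cell Q Γ
  | 0 => .inl (none, none)
  | j + 1 => .inr (fun _ => none, none, L.getD j (false, false))

/-- The bit string described by an initial row. -/
def decodeRaw : List (Bool × Bool) → List Bool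
  | (true, b) :: L => b :: decodeRaw L
  | _ => []

theorem decodeRaw_zero (L : List (Bool × Bool)) : (decodeRaw L)[0]? =
    if (L.getD 0 (false, false)).1 then some (L.getD 0 (false, false)).2 else none := by
  rcases L with _ | ⟨⟨a | a, b⟩, L⟩ <;> simp [decodeRaw]

/-- A local form of the rule that decoding stops at the first invalid pair: a position is filled
only if its predecessor is. This is what `Cell.blocked` passes along the first row, so arbitrary
guessed bits load a genuine string. -/
theorem decodeRaw_succ (L : List (Bool × Bool)) (j : ℕ) : (decodeRaw L)[j + 1]? =
    if (decodeRaw L)[j]?.isNone then none else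
      if (L.getD (j + 1) (false, false)).1 then some (L.getD (j + 1) (false, false)).2
      else none := by
  induction L generalizing j with
  | nil => simp [decodeRaw]
  | cons a L ih =>
    rcases a with ⟨_ | _, b⟩
    · simp [decodeRaw]
    · cases j with
      | zero => simpa [decodeRaw] using decodeRaw_zero L
      | succ j => simpa [decodeRaw] using ih j

theorem decodeRaw_append (x : List Bool) (L : List (Bool × Bool)) :
    decodeRaw (x.map (fun b => (true, b)) ++ L) = x ++ decodeRaw L := by
  induction x with
  | nil => rfl
  | cons b x ih => simp [decodeRaw, ih]

theorem decodeRaw_replicate (L : List (Bool × Bool)) (n : ℕ) :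
    decodeRaw (L ++ List.replicate n (false, false)) = decodeRaw L := by
  induction L with
  | nil => cases n <;> simp [decodeRaw, List.replicate_succ]
  | cons a L ih => rcases a with ⟨_ | _, b⟩ <;> simp [decodeRaw, ih]

theorem decodeRaw_length (L : List (Bool × Bool)) : (decodeRaw L).length ≤ L.length := by
  induction L with
  | nil => simp [decodeRaw]
  | cons a L ih => rcases a with ⟨_ | _, b⟩ <;> simp [decodeRaw, ih]

variable (δ : Q → (∀ k, Option (Γ k)) → Q × Act Γ) (q₀ : Q) (k₀ : K) (sym : Bool → Γ k₀)

/-- The initial configuration of a multi-stack machine. -/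
def initConf (x : List Bool) : Q × ∀ k, List (Γ k) := (q₀, update (fun _ => []) k₀ (x.map sym))

/-- The action that leads to the configuration at time `t`. -/
def actAt (c : Q × ∀ k, List (Γ k)) : ℕ → Option (Act Γ)
  | 0 => none
  | t + 1 => some (δ ((mstep δ)^[t] c).1 fun k => (((mstep δ)^[t] c).2 k).head?).2

/-- The row that describes the configuration at time `t`. -/
def timeRow (c : Q × ∀ k, List (Γ k)) (t : ℕ) : ℕ → Cell Q Γ :=
  rowCell ((mstep δ)^[t] c).1 (actAt δ c t) ((mstep δ)^[t] c).2

theorem cellStep_raw (L : List (Bool × Bool)) (a c : Cell Q Γ) (j : ℕ) :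
    cellStep δ q₀ k₀ sym a (rawCell L (j + 1)) c (timeRow δ (initConf q₀ k₀ sym (decodeRaw L)) 0 j) =
      timeRow δ (initConf q₀ k₀ sym (decodeRaw L)) 0 (j + 1) := by
  have hact : (timeRow δ (initConf q₀ k₀ sym (decodeRaw L)) 0 j).act = none := by cases j <;> rfl
  simp only [cellStep, rawCell, hact]
  simp only [timeRow, rowCell, iterate_zero, id, initConf, actAt, nextConts]
  congr 2
  funext k
  by_cases h : k = k₀
  · subst h
    simp only [update_self, List.getElem?_map]
    cases j with
    | zero =>
      rw [decodeRaw_zero]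
      simp only [Cell.blocked]
      generalize L.getD 0 (false, false) = r
      rcases r with ⟨_ | _, b⟩ <;> rfl
    | succ j =>
      rw [decodeRaw_succ]
      simp only [Cell.blocked, update_self, List.getElem?_map, Option.isNone_map]
      split
      · simp_all
      · split <;> simp_all
  · simp [h]

theorem cellStep_head (a l : Cell Q Γ) (c : Q × ∀ k, List (Γ k)) (t : ℕ) :
    cellStep δ q₀ k₀ sym a (timeRow δ c t 0) (timeRow δ c t 1) l = timeRow δ c (t + 1) 0 := by
  have : (fun k => (((mstep δ)^[t] c).2 k)[0]?) = fun k => (((mstep δ)^[t] c).2 k).head? := by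
    funext k; rw [List.head?_eq_getElem?]
  simp only [cellStep, timeRow, rowCell, Cell.conts, actAt, this, iterate_succ_apply', mstep]

/-- A push takes the symbol of the level above, a pop that of the level below. Only the symbols of
the cell `d` below are constrained, since at the end of a row this cell is already the head of the
next row. -/
theorem cellStep_body (d : Cell Q Γ) (c : Q × ∀ k, List (Γ k)) (t j : ℕ)
    (hd : ∀ k, d.conts k = (((mstep δ)^[t] c).2 k)[j + 1]?) :
    cellStep δ q₀ k₀ sym (timeRow δ c t j) (timeRow δ c t (j + 1)) d (timeRow δ c (t + 1) j) =
      timeRow δ c (t + 1) (j + 1) := by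
  have hact : (timeRow δ c (t + 1) j).act = actAt δ c (t + 1) := by cases j <;> rfl
  have hS : ((mstep δ)^[t + 1] c).2 =
      (δ ((mstep δ)^[t] c).1 fun k => (((mstep δ)^[t] c).2 k).head?).2.apply
        ((mstep δ)^[t] c).2 := by
    rw [iterate_succ_apply']; rfl
  simp only [cellStep, timeRow, rowCell] at hact ⊢
  rw [hact, hS]
  simp only [actAt]
  congr 2
  funext k
  rcases (δ ((mstep δ)^[t] c).1 fun k => (((mstep δ)^[t] c).2 k).head?).2 with _ | ⟨i, _ | g⟩
  · rfl
  · by_cases h : k = i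
    · subst h
      simp [nextConts, Act.apply, hd]
    · simp [nextConts, Act.apply, h]
  · by_cases h : k = i
    · subst h
      cases j <;> simp [nextConts, Act.apply]
    · simp [nextConts, Act.apply, h]

/-- A register that starts with an initial row describes the run of the machine. -/
theorem register_eq_timeRow (g V T : ℕ) (L : List (Bool × Bool)) (v : ℕ → Cell Q Γ)
    (hL : (decodeRaw L).length + T ≤ g + 2)
    (h₀ : ∀ j < g + 3, v (1 + j) = rawCell L j)
    (hv : ∀ i ≤ V, v (i + g + 4) =
      cellStep δ q₀ k₀ sym (v i) (v (i + 1)) (v (i + 2)) (v (i + g + 3))) :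
    ∀ m t j, m = t * (g + 3) + j → t ≤ T → j < g + 3 → m ≤ V →
      v (m + g + 4) = timeRow δ (initConf q₀ k₀ sym (decodeRaw L)) t j := by
  intro m
  induction m using Nat.strong_induction_on with
  | _ m ih =>
    intro t j hm ht hj hmV
    rw [hv m hmV]
    cases t with
    | zero =>
      rw [Nat.zero_mul, Nat.zero_add] at hm
      subst hm
      rw [show m + 1 = 1 + m by omega, h₀ m hj]
      cases m with
      | zero => rfl
      | succ m =>
        rw [show m + 1 + g + 3 = m + g + 4 by omega,
          ih m (by omega) 0 m (by omega) (by omega) (by omega) (by omega)]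
        exact cellStep_raw δ q₀ k₀ sym L _ _ m
    | succ t =>
      rw [Nat.add_mul, Nat.one_mul] at hm
      cases j with
      | zero =>
        rw [show m + 1 = t * (g + 3) + 0 + g + 4 by omega, show m + 2 = t * (g + 3) + 1 + g + 4 by omega,
          ih _ (by omega) t 0 rfl (by omega) (by omega) (by omega),
          ih _ (by omega) t 1 rfl (by omega) (by omega) (by omega)]
        exact cellStep_head δ q₀ k₀ sym _ _ _ t
      | succ j =>
        rw [show v m = v (t * (g + 3) + j + g + 4) by congr 1; omega,
          show m + 1 = t * (g + 3) + (j + 1) + g + 4 by omega,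
          show m + g + 3 = (t + 1) * (g + 3) + j + g + 4 by rw [Nat.add_mul]; omega,
          ih (t * (g + 3) + j) (by omega) t j rfl (by omega) (by omega) (by omega),
          ih (t * (g + 3) + (j + 1)) (by omega) t (j + 1) rfl (by omega) (by omega) (by omega),
          ih ((t + 1) * (g + 3) + j) (by rw [Nat.add_mul]; omega) (t + 1) j rfl (by omega) (by omega)
            (by rw [Nat.add_mul]; omega)]
        refine cellStep_body δ q₀ k₀ sym _ _ t j fun k => ?_
        by_cases hj' : j + 2 < g + 3
        · rw [show m + 2 = t * (g + 3) + (j + 2) + g + 4 by omega,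
            ih (t * (g + 3) + (j + 2)) (by omega) t (j + 2) rfl (by omega) (by omega) (by omega)]
          rfl
        -- At the last cell of a row the right neighbour is the next head, which shows no symbols.
        -- This is correct because `hL` keeps the stacks from reaching that depth.
        · rw [show m + 2 = (t + 1) * (g + 3) + 0 + g + 4 by rw [Nat.add_mul]; omega,
            ih ((t + 1) * (g + 3) + 0) (by rw [Nat.add_mul]; omega) (t + 1) 0 rfl (by omega)
            (by omega) (by rw [Nat.add_mul]; omega)]
          have h1 := length_mstep_le δ (initConf q₀ k₀ sym (decodeRaw L)) t k
          have h2 : ((initConf q₀ k₀ sym (decodeRaw L)).2 k).length ≤ (decodeRaw L).length := by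
            by_cases h : k = k₀
            · subst h; simp [initConf]
            · simp [initConf, h]
          exact (List.getElem?_eq_none (by omega)).symm

end Machine

end RobustlyOften

/-! ### `TM2` machines as multi-stack machines with elementary steps -/

namespace RobustlyOften

open Turing Function

section Micro

variable (tm : FinTM2)

/-- The statements that occur in the program of a machine. -/
def progStmts : Set (TM2.Stmt tm.Γ tm.Λ tm.σ) := {s | s = TM2.Stmt.halt ∨ ∃ l, s ∈ TM2.stmts₁ (tm.m l)}

theorem finite_progStmts : (progStmts tm).Finite := by
  have := tm.ΛFin
  have : progStmts tm ⊆ {TM2.Stmt.halt} ∪ ⋃ l, (TM2.stmts₁ (tm.m l) : Set _) := by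
    rintro s (rfl | ⟨l, hl⟩)
    · exact Or.inl rfl
    · exact Or.inr (Set.mem_iUnion.2 ⟨l, hl⟩)
  exact ((Set.finite_singleton _).union
    (Set.finite_iUnion fun l => Finset.finite_toSet _)).subset this

theorem progStmts_trans {s t : TM2.Stmt tm.Γ tm.Λ tm.σ} (h : s ∈ progStmts tm)
    (ht : t ∈ TM2.stmts₁ s) : t ∈ progStmts tm := by
  rcases h with rfl | ⟨l, hl⟩
  · simp only [TM2.stmts₁, Finset.mem_singleton] at ht
    exact Or.inl ht
  · exact Or.inr ⟨l, TM2.stmts₁_trans hl ht⟩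

/-- The symbols that can occur on a stack. -/
def progSyms (k : tm.K) : Set (tm.Γ k) :=
  {g | (∃ f s v, (TM2.Stmt.push k f s : TM2.Stmt tm.Γ tm.Λ tm.σ) ∈ progStmts tm ∧ f v = g) ∨
    k = tm.k₀ ∨ k = tm.k₁}

/-- A general stack alphabet may be infinite, but only finitely many symbols are ever pushed: one
for each pair of an occurring push statement and a local state. The input and output alphabets are
finite and are kept whole. -/
theorem finite_progSyms [Finite (tm.Γ tm.k₁)] (k : tm.K) : (progSyms tm k).Finite := by
  classical
  have := tm.σFin
  have := tm.Γk₀Fin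
  by_cases h₀ : k = tm.k₀
  · subst h₀; exact Set.toFinite _
  by_cases h₁ : k = tm.k₁
  · subst h₁; exact Set.toFinite _
  let h : TM2.Stmt tm.Γ tm.Λ tm.σ × tm.σ → Option (tm.Γ k) := fun x => match x.1 with
    | .push k' f _ => if e : k' = k then some (e ▸ f x.2) else none
    | _ => none
  have hfin : (h '' (progStmts tm ×ˢ Set.univ)).Finite :=
    ((finite_progStmts tm).prod Set.finite_univ).image h
  refine (hfin.preimage (Option.some_injective _).injOn).subset ?_
  rintro g (⟨f, s, v, hs, rfl⟩ | h | h)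
  · exact ⟨(.push k f s, v), ⟨hs, trivial⟩, by simp [h]⟩
  · exact absurd h h₀
  · exact absurd h h₁

/-- States of the elementary machine: the rest of the current statement and the local variables. -/
abbrev MState : Type := progStmts tm × tm.σ

/-- Symbols of the elementary machine. -/
abbrev MSym (k : tm.K) : Type := progSyms tm k

variable {tm}

/-- Transition function of the elementary machine. -/
def microStep : MState tm → (∀ k, Option (MSym tm k)) → MState tm × Act (MSym tm)
  | (⟨.push k f s, h⟩, v), _ =>
    ((⟨s, progStmts_trans tm h (by simp [TM2.stmts₁, TM2.stmts₁_self])⟩, v),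
      some ⟨k, some ⟨f v, Or.inl ⟨f, s, v, h, rfl⟩⟩⟩)
  | (⟨.peek k f s, h⟩, v), top =>
    ((⟨s, progStmts_trans tm h (by simp [TM2.stmts₁, TM2.stmts₁_self])⟩,
      f v ((top k).map Subtype.val)), none)
  | (⟨.pop k f s, h⟩, v), top =>
    ((⟨s, progStmts_trans tm h (by simp [TM2.stmts₁, TM2.stmts₁_self])⟩,
      f v ((top k).map Subtype.val)), some ⟨k, none⟩)
  | (⟨.load f s, h⟩, v), _ =>
    ((⟨s, progStmts_trans tm h (by simp [TM2.stmts₁, TM2.stmts₁_self])⟩, f v), none)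
  | (⟨.branch p s t, h⟩, v), _ =>
    ((bif p v then ⟨s, progStmts_trans tm h (by simp [TM2.stmts₁, TM2.stmts₁_self])⟩
      else ⟨t, progStmts_trans tm h (by simp [TM2.stmts₁, TM2.stmts₁_self])⟩, v), none)
  | (⟨.goto f, _⟩, v), _ => ((⟨tm.m (f v), Or.inr ⟨f v, TM2.stmts₁_self⟩⟩, v), none)
  | (⟨.halt, h⟩, v), _ => ((⟨.halt, h⟩, v), none)

/-- The statement to be executed at a label, where `none` stands for a halted machine. -/
def labelStmt : Option tm.Λ → progStmts tm
  | none => ⟨TM2.Stmt.halt, Or.inl rfl⟩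
  | some l => ⟨tm.m l, Or.inr ⟨l, TM2.stmts₁_self⟩⟩

/-- Forget that the symbols are among those that can occur. -/
def forgetSyms (S : ∀ k, List (MSym tm k)) : ∀ k, List (tm.Γ k) := fun k => (S k).map Subtype.val

theorem forgetSyms_update (S : ∀ k, List (MSym tm k)) (k : tm.K) (l : List (MSym tm k)) :
    forgetSyms (update S k l) = update (forgetSyms S) k (l.map Subtype.val) := by
  funext j
  by_cases h : j = k
  · subst h; simp [forgetSyms]
  · simp [forgetSyms, h]

/-- The number of elementary steps in a statement. -/
def stmtSize {K : Type} {Γ : K → Type} {Λ σ : Type} : TM2.Stmt Γ Λ σ → ℕ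
  | .push _ _ s => stmtSize s + 1
  | .peek _ _ s => stmtSize s + 1
  | .pop _ _ s => stmtSize s + 1
  | .load _ s => stmtSize s + 1
  | .branch _ s t => stmtSize s + stmtSize t + 1
  | .goto _ => 1
  | .halt => 1

/-- A `TM2` step performs an entire statement, possibly with many stack operations; the elementary
machine unfolds it into single actions, which is the form that the cell rules can follow. -/
theorem micro_stmt (s : TM2.Stmt tm.Γ tm.Λ tm.σ) :
    ∀ (h : s ∈ progStmts tm) (v : tm.σ) (S : ∀ k, List (MSym tm k)),
      ∃ n ≤ stmtSize s, ∃ T, (mstep microStep)^[n] ((⟨s, h⟩, v), S) =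
        ((labelStmt (TM2.stepAux s v (forgetSyms S)).l, (TM2.stepAux s v (forgetSyms S)).var), T) ∧
        (TM2.stepAux s v (forgetSyms S)).stk = forgetSyms T := by
  induction s with
  | push k f s ih =>
    intro h v S
    obtain ⟨n, hn, T, h1, h2⟩ := ih (progStmts_trans tm h (by simp [TM2.stmts₁, TM2.stmts₁_self]))
      v (update S k (⟨f v, Or.inl ⟨f, s, v, h, rfl⟩⟩ :: S k))
    rw [forgetSyms_update] at h1 h2
    exact ⟨n + 1, by simpa [stmtSize] using hn, T, h1, h2⟩
  | peek k f s ih =>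
    intro h v S
    obtain ⟨n, hn, T, h1, h2⟩ := ih (progStmts_trans tm h (by simp [TM2.stmts₁, TM2.stmts₁_self]))
      (f v (forgetSyms S k).head?) S
    refine ⟨n + 1, by simpa [stmtSize] using hn, T, ?_, h2⟩
    rw [iterate_succ_apply, TM2.stepAux, ← h1]
    simp only [mstep, microStep, forgetSyms, List.head?_map, Act.apply]
  | pop k f s ih =>
    intro h v S
    obtain ⟨n, hn, T, h1, h2⟩ := ih (progStmts_trans tm h (by simp [TM2.stmts₁, TM2.stmts₁_self]))
      (f v (forgetSyms S k).head?) (update S k (S k).tail)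
    rw [forgetSyms_update, List.map_tail] at h1 h2
    refine ⟨n + 1, by simpa [stmtSize] using hn, T, ?_, h2⟩
    rw [iterate_succ_apply, TM2.stepAux]
    refine Eq.trans ?_ h1
    simp only [mstep, microStep, forgetSyms, List.head?_map, Act.apply]
  | load f s ih =>
    intro h v S
    obtain ⟨n, hn, T, h1, h2⟩ := ih (progStmts_trans tm h (by simp [TM2.stmts₁, TM2.stmts₁_self]))
      (f v) S
    exact ⟨n + 1, by simpa [stmtSize] using hn, T, h1, h2⟩
  | branch p s t ihs iht =>
    intro h v S
    rw [TM2.stepAux]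
    cases hp : p v
    · obtain ⟨n, hn, T, h1, h2⟩ := iht
        (progStmts_trans tm h (by simp [TM2.stmts₁, TM2.stmts₁_self])) v S
      refine ⟨n + 1, by simp [stmtSize]; omega, T, ?_, h2⟩
      rw [iterate_succ_apply]
      refine Eq.trans ?_ h1
      simp only [mstep, microStep, hp, cond_false, Act.apply]
    · obtain ⟨n, hn, T, h1, h2⟩ := ihs
        (progStmts_trans tm h (by simp [TM2.stmts₁, TM2.stmts₁_self])) v S
      refine ⟨n + 1, by simp [stmtSize]; omega, T, ?_, h2⟩
      rw [iterate_succ_apply]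
      refine Eq.trans ?_ h1
      simp only [mstep, microStep, hp, cond_true, Act.apply]
  | goto f => intro h v S; exact ⟨1, le_rfl, S, rfl, rfl⟩
  | halt => intro h v S; exact ⟨0, by simp, S, rfl, rfl⟩

theorem exists_stmtSize_le (tm : FinTM2) : ∃ D, ∀ l, stmtSize (tm.m l) ≤ D := by
  have := tm.ΛFin
  obtain ⟨D, hD⟩ := (Set.finite_range fun l => stmtSize (tm.m l)).bddAbove
  exact ⟨D, fun l => hD ⟨l, rfl⟩⟩

theorem micro_run {D : ℕ} (hD : ∀ l, stmtSize (tm.m l) ≤ D) (n : ℕ) :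
    ∀ (l : Option tm.Λ) (v : tm.σ) (S : ∀ k, List (MSym tm k)) (b : tm.Cfg),
      Reach tm.step ⟨l, v, forgetSyms S⟩ b n →
      ∃ n' ≤ D * n, ∃ T, (mstep microStep)^[n'] ((labelStmt l, v), S) =
        ((labelStmt b.l, b.var), T) ∧ b.stk = forgetSyms T := by
  induction n with
  | zero =>
    intro l v S b h
    obtain rfl : _ = b := Option.some.inj h
    exact ⟨0, by simp, S, rfl, rfl⟩
  | succ n ih =>
    intro l v S b h
    cases l with
    | none =>
      -- A halted configuration has no successor, so this case is contradictory.
      unfold Reach at h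
      rw [iterate_succ_apply] at h
      have : (flip bind tm.step) (some ⟨none, v, forgetSyms S⟩) = none := rfl
      rw [this, iterate_fixed (by rfl)] at h
      simp at h
    | some l =>
      obtain ⟨m, hm, T, h1, h2⟩ := micro_stmt (tm.m l) (labelStmt (some l)).2 v S
      have h3 : Reach tm.step ⟨(TM2.stepAux (tm.m l) v (forgetSyms S)).l,
          (TM2.stepAux (tm.m l) v (forgetSyms S)).var, forgetSyms T⟩ b n := by
        rw [← h2]
        exact h
      obtain ⟨n', hn', T', h4, h5⟩ := ih _ _ _ _ h3
      refine ⟨n' + m, ?_, T', ?_, h5⟩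
      · have := hm.trans (hD l)
        rw [Nat.mul_succ]; omega
      · rw [iterate_add_apply]
        have h1' : (mstep microStep)^[m] ((labelStmt (some l), v), S) = _ := h1
        rw [h1', h4]

theorem mstep_halt (v : tm.σ) (S : ∀ k, List (MSym tm k)) :
    mstep microStep ((labelStmt none, v), S) = ((labelStmt none, v), S) := rfl

end Micro

section Decider

variable (tm : FinTM2)

/-- An input symbol of the elementary machine. -/
def inSym (e : tm.Γ tm.k₀ ≃ Bool) (b : Bool) : MSym tm tm.k₀ := ⟨e.symm b, Or.inr (Or.inl rfl)⟩

/-- The start state of the elementary machine. -/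
def startState : MState tm := (labelStmt (some tm.main), tm.initialState)

/-- The cell below the head of a row that describes a halted machine with output `b`. -/
def finCell (e : tm.Γ tm.k₁ ≃ Bool) (b : Bool) : Cell (MState tm) (MSym tm) :=
  .inr (update (fun _ => none) tm.k₁ (some ⟨e.symm b, Or.inr (Or.inr rfl)⟩), some none,
    (false, false))

theorem finCell_injective (e : tm.Γ tm.k₁ ≃ Bool) : Injective (finCell tm e) := by
  intro a b h
  simp only [finCell, Sum.inr.injEq, Prod.mk.injEq, and_true] at h
  have := congrFun h tm.k₁
  rw [update_self, update_self] at this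
  exact e.symm.injective (congrArg Subtype.val (Option.some.inj this))

/-- The elementary machine idles after halting. The extra unit in `hT` ensures that the step leading
to row `T` is itself idle, so the recorded action is `some none` as in `finCell`; the answer then
stands in the cell of the stack tops. -/
theorem timeRow_of_outputs (e₀ : tm.Γ tm.k₀ ≃ Bool) (e₁ : tm.Γ tm.k₁ ≃ Bool) {D : ℕ}
    (hD : ∀ l, stmtSize (tm.m l) ≤ D) (x : List Bool) (b : Bool) (n T : ℕ)
    (h : Reach tm.step (initList tm (x.map e₀.symm)) (haltList tm [e₁.symm b]) n)
    (hT : D * n + 1 ≤ T) :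
    timeRow microStep (initConf (startState tm) tm.k₀ (inSym tm e₀) x) T 1 = finCell tm e₁ b := by
  have e : initList tm (x.map e₀.symm) = ⟨some tm.main, tm.initialState,
      forgetSyms (initConf (startState tm) tm.k₀ (inSym tm e₀) x).2⟩ := by
    rw [initList_eq]
    congr 1
    simp only [initConf, forgetSyms_update]
    congr 1
    simp [inSym, Function.comp_def]
  rw [e, haltList_eq] at h
  obtain ⟨m, hm, S, h1, h2⟩ := micro_run hD n _ _ _ _ h
  have h3 : ∀ t, m ≤ t → (mstep microStep)^[t] (initConf (startState tm) tm.k₀ (inSym tm e₀) x) =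
      ((labelStmt none, tm.initialState), S) := by
    intro t ht
    obtain ⟨d, rfl⟩ := Nat.exists_eq_add_of_le' ht
    rw [iterate_add_apply]
    have h1' : (mstep microStep)^[m] (initConf (startState tm) tm.k₀ (inSym tm e₀) x) = _ := h1
    rw [h1']
    exact iterate_fixed (mstep_halt _ _) d
  obtain ⟨T, rfl⟩ : ∃ T', T = T' + 1 := ⟨T - 1, by omega⟩
  simp only [timeRow, rowCell, actAt]
  rw [h3 T (by omega), h3 (T + 1) (by omega)]
  simp only [finCell]
  congr 2
  funext k
  have h4 : forgetSyms S k = _ := (congrFun h2 k).symm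
  by_cases hk : k = tm.k₁
  · subst hk
    simp only [update_self, forgetSyms] at h4 ⊢
    rw [List.map_eq_singleton_iff] at h4
    obtain ⟨a, ha, ha'⟩ := h4
    simp only [ha, List.getElem?_cons_zero]
    congr 1
    exact Subtype.ext ha'
  · simp only [update_of_ne hk, forgetSyms, List.map_eq_nil_iff] at h4 ⊢
    rw [h4]
    rfl

end Decider

end RobustlyOften

/-! ### Hardness of satisfiability of bit clause formulas -/

namespace RobustlyOften

open Turing Function

/-! ### Bit codes of cells and patterns for the initial row -/

section Encoding

variable {Q : Type} {K : Type} {Γ : K → Type}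

/-- The two input bits of a cell. -/
def Cell.raw : Cell Q Γ → Bool × Bool
  | .inl _ => (false, false)
  | .inr c => c.2.2

/-- A cell without its input bits. -/
def Cell.strip : Cell Q Γ → Cell Q Γ
  | .inl c => .inl c
  | .inr c => .inr (c.1, c.2.1, (false, false))

theorem Cell.ext_raw {c d : Cell Q Γ} (h : c.raw = d.raw) (h' : c.strip = d.strip) : c = d := by
  rcases c with c | ⟨a, b, r⟩ <;> rcases d with d | ⟨a', b', r'⟩ <;>
    simp_all [Cell.raw, Cell.strip]

variable [Fintype (Cell Q Γ)]

/-- One-hot code of a cell without its input bits. -/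
noncomputable def codeCell (c : Cell Q Γ) : List Bool :=
  List.ofFn fun i => decide (Fintype.equivFin (Cell Q Γ) c.strip = i)

/-- The code of a cell. -/
noncomputable def encCell (c : Cell Q Γ) : List Bool := c.raw.1 :: c.raw.2 :: codeCell c

/-- The length of the code of a cell. -/
def cellWidth (Q : Type) (Γ : K → Type) [Fintype (Cell Q Γ)] : ℕ := Fintype.card (Cell Q Γ) + 2

theorem length_encCell (c : Cell Q Γ) : (encCell c).length = cellWidth Q Γ := by
  simp [encCell, codeCell, cellWidth]

theorem codeCell_strip {c d : Cell Q Γ} (h : codeCell c = codeCell d) : c.strip = d.strip := by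
  have h1 := congrFun (List.ofFn_injective h) (Fintype.equivFin (Cell Q Γ) c.strip)
  simp only [decide_true] at h1
  exact ((Fintype.equivFin _).injective (of_decide_eq_true h1.symm)).symm

theorem encCell_injective : Injective (encCell : Cell Q Γ → List Bool) := by
  intro c d h
  simp only [encCell, List.cons.injEq] at h
  exact Cell.ext_raw (Prod.ext h.1 h.2.1) (codeCell_strip h.2.2)

/-- A cell below the head in the initial row. -/
def rawBody (r : Bool × Bool) : Cell Q Γ := .inr (fun _ => none, none, r)

/-- The pattern that a given cell matches. -/
noncomputable def knownPat (c : Cell Q Γ) : Pat := (encCell c).map some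

variable (Q Γ) in
/-- The pattern of a cell with unknown input bits in the initial row. -/
noncomputable def guessPat : Pat :=
  none :: none :: (codeCell (rawBody (false, false) : Cell Q Γ)).map some

theorem matchAll_knownPat (c d : Cell Q Γ) : matchAll (knownPat c) (encCell d) = true ↔ d = c := by
  rw [knownPat, matchAll_some]
  constructor
  · intro h
    exact (encCell_injective (h.eq_of_length (by simp [length_encCell]))).symm
  · rintro rfl
    exact List.prefix_refl _

theorem matchAll_guessPat (d : Cell Q Γ) :
    matchAll (guessPat Q Γ) (encCell d) = true ↔ ∃ r, d = rawBody r := by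
  simp only [guessPat, matchAll, encCell, List.tail_cons, matchAll_some]
  constructor
  · intro h
    have h1 := codeCell_strip (h.eq_of_length (by simp [codeCell]))
    refine ⟨d.raw, Cell.ext_raw rfl h1.symm⟩
  · rintro ⟨r, rfl⟩
    exact List.prefix_refl _

/-- The part of the input of a verifier that does not depend on the certificate. -/
def pairHead (x : List Bool) : List Bool := x.flatMap (fun b => [b, b]) ++ [false, true]

theorem length_pairHead (x : List Bool) : (pairHead x).length = 2 * x.length + 2 := by
  simp [pairHead, List.length_flatMap]
  omega

variable (Q Γ) in
/-- The patterns of the initial cells of the register. -/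
noncomputable def initPats (x : List Bool) (p q : ℕ) : List Pat :=
  knownPat (.inl (none, none) : Cell Q Γ) :: knownPat (.inl (none, none) : Cell Q Γ) ::
    ((pairHead x).map (fun b => knownPat (rawBody (true, b) : Cell Q Γ)) ++
      (List.replicate p (guessPat Q Γ) ++
        List.replicate q (knownPat (rawBody (false, false) : Cell Q Γ))))

theorem length_initPats (x : List Bool) (p q : ℕ) :
    (initPats Q Γ x p q).length = 2 * x.length + p + q + 4 := by
  simp [initPats, length_pairHead]
  omega

theorem mem_initPats {x : List Bool} {p q : ℕ} {P : Pat} (hP : P ∈ initPats Q Γ x p q) :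
    (∃ c : Cell Q Γ, P = knownPat c) ∨ P = guessPat Q Γ := by
  simp only [initPats, List.mem_cons, List.mem_append, List.mem_map, List.mem_replicate] at hP
  rcases hP with rfl | rfl | ⟨b, -, rfl⟩ | ⟨-, rfl⟩ | ⟨-, rfl⟩
  · exact Or.inl ⟨_, rfl⟩
  · exact Or.inl ⟨_, rfl⟩
  · exact Or.inl ⟨_, rfl⟩
  · exact Or.inr rfl
  · exact Or.inl ⟨_, rfl⟩

/-- Each of the four choices of the two free bits in `guessPat` completes it to the code of a cell,
so the initial blocks are always valid. -/
theorem initPats_spec {x : List Bool} {p q : ℕ} : ∀ P ∈ initPats Q Γ x p q,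
    P.length = cellWidth Q Γ ∧ ∀ Z : List Bool, cellWidth Q Γ ≤ Z.length →
      matchAll P Z = true → ∃ a : Cell Q Γ, encCell a <+: Z := by
  intro P hP
  rcases mem_initPats hP with ⟨c, rfl⟩ | rfl
  · refine ⟨by rw [knownPat, List.length_map, length_encCell], fun Z _ h => ⟨c, ?_⟩⟩
    rwa [knownPat, matchAll_some] at h
  · refine ⟨by simp [guessPat, codeCell, cellWidth], fun Z hZ h => ?_⟩
    rcases Z with _ | ⟨a, _ | ⟨b, Z⟩⟩
    · simp [cellWidth] at hZ
    · simp [cellWidth] at hZ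
    · simp only [guessPat, matchAll, List.tail_cons, matchAll_some] at h
      refine ⟨rawBody (a, b), ?_⟩
      have e : encCell (rawBody (a, b) : Cell Q Γ) =
          a :: b :: codeCell (rawBody (false, false) : Cell Q Γ) := rfl
      rw [e, List.cons_prefix_cons, List.cons_prefix_cons]
      exact ⟨rfl, rfl, h⟩

/-- The input bits of the initial row. -/
def rawList (x : List Bool) (G : List (Bool × Bool)) (q : ℕ) : List (Bool × Bool) :=
  (pairHead x).map (fun b => (true, b)) ++ (G ++ List.replicate q (false, false))

/-- Cell `0` is a dummy left neighbour. The row starting at cell `1` consists of a head, the fixed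
part of the pair, `p` guessed cells, and `q` empty cells that leave room for the stacks to grow. -/
theorem initPats_match_iff (x : List Bool) (p q : ℕ) (v : ℕ → Cell Q Γ) :
    (∀ i P, (initPats Q Γ x p q)[i]? = some P → matchAll P (encCell (v i)) = true) ↔
      ∃ G : List (Bool × Bool), G.length = p ∧ v 0 = .inl (none, none) ∧
        ∀ j < 2 * x.length + p + q + 3, v (1 + j) = rawCell (rawList x G q) j := by
  have hlen := length_pairHead x
  constructor
  · intro h
    have hT : ∀ j P, ((pairHead x).map (fun b => knownPat (rawBody (true, b) : Cell Q Γ)) ++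
      (List.replicate p (guessPat Q Γ) ++
        List.replicate q (knownPat (rawBody (false, false) : Cell Q Γ))))[j]? = some P →
        matchAll P (encCell (v (j + 2))) = true := fun j P hj => h (j + 2) P (by simpa [initPats] using hj)
    -- The guess is read off from the input bits of the `p` unspecified cells, which follow the two
    -- leading cells and `pairHead x`.
    refine ⟨(List.range p).map fun j => (v ((pairHead x).length + j + 2)).raw, by simp,
      (matchAll_knownPat _ _).1 (h 0 _ rfl), fun j hj => ?_⟩
    cases j with
    | zero => exact (matchAll_knownPat _ _).1 (h 1 _ rfl)
    | succ j =>
      rw [show 1 + (j + 1) = j + 2 by omega]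
      change _ = rawBody _
      rw [List.getD_eq_getElem?_getD, rawList]
      by_cases h1 : j < (pairHead x).length
      · have h2 := hT j (knownPat (rawBody (true, (pairHead x)[j]) : Cell Q Γ)) (by
          rw [List.getElem?_append_left (by simpa using h1)]; simp [h1])
        rw [matchAll_knownPat] at h2
        rw [h2, List.getElem?_append_left (by simpa using h1)]
        simp [h1]
      · rw [List.getElem?_append_right (by simpa using h1)]
        by_cases h3 : j < (pairHead x).length + p
        · have h2 := hT j (guessPat Q Γ) (by
            rw [List.getElem?_append_right (by simpa using h1), List.getElem?_append_left
              (by simp; omega)]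
            simp only [List.getElem?_replicate, List.length_map]
            rw [if_pos (by omega)])
          rw [matchAll_guessPat] at h2
          obtain ⟨r, hr⟩ := h2
          rw [List.getElem?_append_left (by simp; omega)]
          have h4 : j - (pairHead x).length < p := by omega
          simp only [List.length_map, List.getElem?_map, List.getElem?_range h4, Option.map_some,
            Option.getD_some]
          rw [show (pairHead x).length + (j - (pairHead x).length) + 2 = j + 2 by omega, hr]
          rfl
        · have h2 := hT j (knownPat (rawBody (false, false) : Cell Q Γ)) (by
            rw [List.getElem?_append_right (by simpa using h1), List.getElem?_append_right
              (by simp; omega)]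
            simp only [List.getElem?_replicate, List.length_map, List.length_replicate]
            rw [if_pos (by omega)])
          rw [matchAll_knownPat] at h2
          rw [h2, List.getElem?_append_right (by simp; omega)]
          simp only [List.getElem?_replicate]
          split <;> rfl
  · rintro ⟨G, hG, h0, hv⟩ i P hP
    rcases i with _ | _ | j
    · obtain rfl := Option.some.inj hP
      exact (matchAll_knownPat _ _).2 h0
    · obtain rfl := Option.some.inj hP
      exact (matchAll_knownPat _ _).2 (hv 0 (by omega))
    · have hj : j + 1 + 1 < (initPats Q Γ x p q).length := (List.getElem?_eq_some_iff.1 hP).1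
      rw [length_initPats] at hj
      have h1 := hv (j + 1) (by omega)
      rw [show 1 + (j + 1) = j + 1 + 1 by omega] at h1
      rw [h1]
      simp only [initPats, List.getElem?_cons_succ] at hP
      change matchAll P (encCell (rawBody _)) = true
      rw [List.getD_eq_getElem?_getD, rawList]
      by_cases h1 : j < (pairHead x).length
      · rw [List.getElem?_append_left (by simpa using h1)] at hP ⊢
        simp only [List.getElem?_map, List.getElem?_eq_getElem h1, Option.map_some,
          Option.some.injEq] at hP
        subst hP
        rw [matchAll_knownPat]
        simp [h1]
      · rw [List.getElem?_append_right (by simpa using h1)] at hP ⊢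
        by_cases h3 : j < (pairHead x).length + p
        · rw [List.getElem?_append_left (by simp; omega)] at hP
          simp only [List.getElem?_replicate] at hP
          split at hP
          · obtain rfl := Option.some.inj hP
            rw [matchAll_guessPat]
            exact ⟨_, rfl⟩
          · simp at hP
        · rw [List.getElem?_append_right (by simp; omega)] at hP ⊢
          simp only [List.getElem?_replicate] at hP ⊢
          split at hP
          · obtain rfl := Option.some.inj hP
            rw [matchAll_knownPat]
            split <;> rfl
          · simp at hP

end Encoding

section Instance

variable {K : Type} [DecidableEq K] {Γ : K → Type} {Q : Type} [Fintype (Cell Q Γ)]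
variable (δ : Q → (∀ k, Option (Γ k)) → Q × Act Γ) (q₀ : Q) (k₀ : K) (sym : Bool → Γ k₀)

/-- The formula for the runs of a machine over `q` steps, with a certificate of length at most `p`,
that end with the cell `fin` below the head. -/
noncomputable def machineFormula (fin : Cell Q Γ) (x : List Bool) (p q : ℕ) : List Bool :=
  formula (framePat (cellWidth Q Γ) ((2 * x.length + p + q + 3) * q + 1) (initPats Q Γ x p q)
      (encCell fin))
    (allClauses (cellWidth Q Γ) (2 * x.length + p + q) ((2 * x.length + p + q + 3) * q + 1 + 1)
      (stepPats encCell (cellWidth Q Γ) (cellStep δ q₀ k₀ sym)))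

theorem length_encode (ts : List Tok) : (encode ts).length = 3 * ts.length := by
  induction ts with
  | nil => rfl
  | cons t ts ih =>
    rw [encode_cons, List.length_append, ih]
    cases t <;> simp [Tok.bits] <;> omega

/-- The frame alone spends a three-bit instruction on every bit of the register string. Hence the
bound `y.length ≤ x.length` in `clauseSat` excludes no intended solution. -/
theorem le_length_machineFormula (fin : Cell Q Γ) (x : List Bool) (p q : ℕ) :
    (2 * x.length + p + q + ((2 * x.length + p + q + 3) * q + 1) + 5) * cellWidth Q Γ ≤
      (machineFormula δ q₀ k₀ sym fin x p q).length := by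
  rw [machineFormula, formula, length_encode, List.length_append, List.length_map, framePat,
    List.length_append, List.length_append, List.length_replicate, List.length_map, length_encCell,
    flatten_length (w := cellWidth Q Γ) _ fun P hP => (initPats_spec P hP).1, length_initPats]
  generalize (2 * x.length + p + q + 3) * q = m
  generalize cellWidth Q Γ = w
  ring_nf
  omega

/-- With `g = 2 * x.length + p + q`, the initial row holds an input of length at most `2 * x.length
+ 2 + p` and leaves room for `q` pushes. -/
theorem machineFormula_sat_iff (fin : Cell Q Γ) (x : List Bool) (p q : ℕ) :
    machineFormula δ q₀ k₀ sym fin x p q ∈ clauseSat ↔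
      ∃ G : List (Bool × Bool), G.length = p ∧
        timeRow δ (initConf q₀ k₀ sym (pairHead x ++ decodeRaw G)) q 1 = fin := by
  have hdec : ∀ G, decodeRaw (rawList x G q) = pairHead x ++ decodeRaw G := by
    intro G
    rw [rawList, decodeRaw_append, decodeRaw_replicate]
  have hrun : ∀ (G : List (Bool × Bool)) (v : ℕ → Cell Q Γ), G.length = p →
      (∀ j < 2 * x.length + p + q + 3, v (1 + j) = rawCell (rawList x G q) j) →
      (∀ i ≤ (2 * x.length + p + q + 3) * q + 1, v (i + (2 * x.length + p + q) + 4) =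
        cellStep δ q₀ k₀ sym (v i) (v (i + 1)) (v (i + 2)) (v (i + (2 * x.length + p + q) + 3))) →
      v (2 * x.length + p + q + ((2 * x.length + p + q + 3) * q + 1) + 4) =
        timeRow δ (initConf q₀ k₀ sym (pairHead x ++ decodeRaw G)) q 1 := by
    intro G v hG h0 hv
    -- The index `(g + 3) * q + 1` is position `1` of row `q`, the cell with the stack tops.
    have h1 := register_eq_timeRow δ q₀ k₀ sym (2 * x.length + p + q) _ q (rawList x G q) v (by
      rw [hdec, List.length_append, length_pairHead]
      have := decodeRaw_length G
      omega) h0 hv ((2 * x.length + p + q + 3) * q + 1) q 1 (by ring) le_rfl (by omega) le_rfl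
    rw [hdec] at h1
    rw [← h1]
    congr 1
    omega
  have h1 := register_sat_iff (F := cellStep δ q₀ k₀ sym) length_encCell encCell_injective
    (2 * x.length + p + q) ((2 * x.length + p + q + 3) * q + 1) (initPats Q Γ x p q) fin
    (length_initPats x p q) initPats_spec _ (le_length_machineFormula δ q₀ k₀ sym fin x p q)
  simp only [← check_formula] at h1
  refine h1.trans ?_
  simp only [initPats_match_iff]
  constructor
  · rintro ⟨v, ⟨G, hG, -, h0⟩, hv, hfin⟩
    exact ⟨G, hG, by rw [← hfin, hrun G v hG h0 hv]⟩
  · rintro ⟨G, hG, hfin⟩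
    obtain ⟨v, hv0, hv⟩ := exists_register (cellStep δ q₀ k₀ sym)
      (fun i => match i with
        | 0 => .inl (none, none)
        | j + 1 => rawCell (rawList x G q) j) (2 * x.length + p + q)
    have h0 : ∀ j < 2 * x.length + p + q + 3, v (1 + j) = rawCell (rawList x G q) j := by
      intro j hj
      rw [Nat.add_comm, hv0 (j + 1) (by omega)]
    exact ⟨v, ⟨G, hG, hv0 0 (by omega), h0⟩, fun i _ => hv i,
      by rw [hrun G v hG h0 fun i _ => hv i, hfin]⟩

end Instance

theorem pairHead_append (x y : List Bool) : pairHead x ++ y = pair x y := by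
  simp [pairHead, pair]

/-- Padding with invalid pairs represents every string of length at most `p` by exactly `p` cells.
-/
theorem exists_decodeRaw (p : ℕ) (P : List Bool → Prop) :
    (∃ G : List (Bool × Bool), G.length = p ∧ P (decodeRaw G)) ↔
      ∃ y : List Bool, y.length ≤ p ∧ P y := by
  constructor
  · rintro ⟨G, rfl, h⟩
    exact ⟨_, decodeRaw_length G, h⟩
  · rintro ⟨y, hy, h⟩
    refine ⟨y.map (fun b => (true, b)) ++ List.replicate (p - y.length) (false, false), ?_, ?_⟩
    · simp; omega
    · rw [decodeRaw_replicate]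
      have := decodeRaw_append y []
      simp only [List.append_nil, decodeRaw] at this
      rwa [this]

/-- Polynomially bounded search for a certificate that makes a polynomial-time decision procedure
answer `b` amounts to satisfiability of the formulas for a fixed machine. -/
theorem exists_machineFormula {f : List Bool → Bool}
    (M : TM2ComputableInPolyTime (id : List Bool → List Bool) Computability.encodeBool f) (b : Bool)
    (p : Polynomial ℕ) :
    ∃ (K : Type) (_ : DecidableEq K) (Γ : K → Type) (Q : Type) (_ : Fintype (Cell Q Γ))
      (δ : Q → (∀ k, Option (Γ k)) → Q × Act Γ) (q₀ : Q) (k₀ : K) (sym : Bool → Γ k₀)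
      (fin : Cell Q Γ) (q : Polynomial ℕ), ∀ x,
        machineFormula δ q₀ k₀ sym fin x (p.eval x.length) (q.eval x.length) ∈ clauseSat ↔
          ∃ y : List Bool, y.length ≤ p.eval x.length ∧ f (pair x y) = b := by
  classical
  obtain ⟨D, hD⟩ := exists_stmtSize_le M.tm
  have := M.tm.kFin
  have := M.tm.σFin
  have : Finite (M.tm.Γ M.tm.k₁) := Finite.of_equiv _ M.outputAlphabet.symm
  have : Finite (progStmts M.tm) := finite_progStmts M.tm
  have : ∀ k, Finite (MSym M.tm k) := fun k => finite_progSyms M.tm k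
  have : Finite (Cell (MState M.tm) (MSym M.tm)) := by unfold Cell; infer_instance
  let _ : Fintype (Cell (MState M.tm) (MSym M.tm)) := Fintype.ofFinite _
  -- The number of rows allows `D` elementary steps for each step of `M` on a pair of maximal
  -- length, plus the final idle step.
  refine ⟨M.tm.K, inferInstance, MSym M.tm, MState M.tm, inferInstance, microStep,
    startState M.tm, M.tm.k₀, inSym M.tm M.inputAlphabet, finCell M.tm M.outputAlphabet b,
    Polynomial.C D * M.time.comp (2 * Polynomial.X + 2 + p) + 1, fun x => ?_⟩
  rw [machineFormula_sat_iff, ← exists_decodeRaw _ fun y => f (pair x y) = b]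
  refine exists_congr fun G => and_congr_right fun hG => ?_
  obtain ⟨⟨n, hn⟩, hnt⟩ := M.outputsFun (pairHead x ++ decodeRaw G)
  have hlen : (pairHead x ++ decodeRaw G).length ≤ 2 * x.length + 2 + p.eval x.length := by
    rw [List.length_append, length_pairHead]
    have := decodeRaw_length G
    omega
  have hn' : n ≤ M.time.eval (2 * x.length + 2 + p.eval x.length) :=
    le_trans hnt (Polynomial.eval_mono_nat M.time hlen)
  rw [timeRow_of_outputs M.tm M.inputAlphabet M.outputAlphabet hD (pairHead x ++ decodeRaw G)
    (f (pairHead x ++ decodeRaw G)) n _ hn, pairHead_append]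
  · exact (finCell_injective M.tm M.outputAlphabet).eq_iff
  · simp only [Polynomial.eval_add, Polynomial.eval_mul, Polynomial.eval_comp, Polynomial.eval_one,
      Polynomial.eval_C, Polynomial.eval_X, Polynomial.eval_ofNat]
    exact Nat.add_le_add_right (Nat.mul_le_mul_left D hn') 1

end RobustlyOften

/-! ### The formulas of a machine are computable in polynomial time -/

namespace RobustlyOften

open Turing Function

namespace Cmd

variable {R : Type}

/-- Push all bits of a fixed list. -/
def pushAll (o : R) : List Bool → Cmd R
  | [] => skip
  | b :: l => seq (push o b) (pushAll o l)

/-- Push the list `l b` for each bit `b` of the register `a`; the register `t` is auxiliary. -/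
def expand (a t o : R) (l : Bool → List Bool) : Cmd R :=
  seq (loop a fun b => seq (push t b) (pushAll o (l b))) (moveRev t a)

end Cmd

open Cmd

section Macros

variable {R : Type} [DecidableEq R]

theorem exec_pushAll (o : R) (l : List Bool) (s : Store R) :
    Exec (pushAll o l) s (update s o (l.reverse ++ s o)) (l.length + 1) := by
  induction l generalizing s with
  | nil => exact Exec.skip.congr (by simp)
  | cons b l ih =>
    exact (((Exec.push rfl).seq (ih _)).mono (by simp; omega)).congr (by simp)

theorem exec_expand {a t o : R} (hat : a ≠ t) (hao : a ≠ o) (hto : t ≠ o) (l : Bool → List Bool)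
    (s : Store R) (ht : s t = []) :
    Exec (expand a t o l) s (update s o (((s a).flatMap l).reverse ++ s o))
      (((l true).length + (l false).length + 5) * (s a).length + 2) := by
  have h₁ := Exec.loop (r := a) (k := fun b => seq (push t b) (pushAll o (l b)))
    (B := (l true).length + (l false).length + 2) (s a)
    (fun p m => update (update (update s a m) t p.reverse) o ((p.flatMap l).reverse ++ s o))
    (fun p m => by simp [hat, hao]) (fun p x m _ => by
      refine (((Exec.push rfl).seq (exec_pushAll o (l x) _)).mono ?_).congr ?_
      · cases x <;> omega
      · funext r
        by_cases k₁ : r = o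
        · subst k₁; simp [hto.symm, hao.symm]
        · by_cases k₂ : r = t
          · subst k₂; simp [hto, hat.symm]
          · by_cases k₃ : r = a
            · subst k₃; simp [k₁, k₂]
            · simp [k₁, k₂, k₃])
  have e : update (update (update s a (s a)) t [].reverse) o ((([] : List Bool).flatMap l).reverse ++
      s o) = s := by
    funext r
    by_cases k₁ : r = o
    · subst k₁; simp
    · by_cases k₂ : r = t
      · subst k₂; simp [k₁, ht]
      · simp [k₁, k₂]
  rw [e] at h₁
  refine ((h₁.seq (exec_moveRev hat.symm _)).mono ?_).congr ?_
  · simp only [ne_eq, hto, not_false_eq_true, update_of_ne, update_self, List.length_reverse]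
    ring_nf
    omega
  · funext r
    by_cases k₁ : r = o
    · subst k₁; simp [hao.symm, hto.symm]
    · by_cases k₂ : r = a
      · subst k₂; simp [k₁, hat, hto]
      · by_cases k₃ : r = t
        · subst k₃; simp [k₁, k₂, ht]
        · simp [k₁, k₂, k₃]

end Macros

/-! ### Uniform polynomial time and unary arithmetic -/

section PolyExec

variable {R : Type} [DecidableEq R] {I : Type} {size : I → ℕ} {s s₁ s₂ : I → Store R}

/-- A fixed program leads from `s i` to `s₁ i` in time polynomial in the size of `i`. -/
def PolyExec (size : I → ℕ) (s s₁ : I → Store R) : Prop :=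
  ∃ (c : Cmd R) (P : Polynomial ℕ), ∀ i, Exec c (s i) (s₁ i) (P.eval (size i))

theorem PolyExec.trans (h : PolyExec size s s₁) (h' : PolyExec size s₁ s₂) :
    PolyExec size s s₂ := by
  obtain ⟨c, P, h⟩ := h
  obtain ⟨d, P', h'⟩ := h'
  exact ⟨.seq c d, P + P', fun i => by
    rw [Polynomial.eval_add]
    exact (h i).seq (h' i)⟩

theorem PolyExec.congr (h : PolyExec size s s₁) (hs : ∀ i, s₁ i = s₂ i) : PolyExec size s s₂ := by
  rwa [← funext hs]

theorem polyExec_clear (a : R) (N : Polynomial ℕ) (hN : ∀ i, (s i a).length ≤ N.eval (size i)) :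
    PolyExec size s fun i => update (s i) a [] :=
  ⟨clear a, 2 * N + 1, fun i => (exec_clear a (s i)).mono (by
    have := hN i
    simp
    omega)⟩

theorem polyExec_pushAll (o : R) (l : List Bool) :
    PolyExec size s fun i => update (s i) o (l.reverse ++ s i o) :=
  ⟨pushAll o l, Polynomial.C (l.length + 1), fun i => by
    rw [Polynomial.eval_C]
    exact exec_pushAll o l (s i)⟩

/-- Evaluation of a polynomial at a number in unary. -/
theorem polyExec_polynomial {a r t u : R} (har : a ≠ r) (hat : a ≠ t) (hau : a ≠ u) (hrt : r ≠ t)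
    (hru : r ≠ u) (htu : t ≠ u) (p : Polynomial ℕ) (ha : ∀ i, (s i a).length ≤ size i)
    (hr : ∀ i, s i r = []) (ht : ∀ i, s i t = []) (hu : ∀ i, s i u = []) :
    PolyExec size s fun i => update (s i) r (List.replicate (p.eval (s i a).length) true) := by
  induction p using Polynomial.recOnHorner with
  | M0 => exact ⟨.skip, 1, fun i => by simpa [← hr i] using Exec.skip⟩
  | MC p b _ _ ih =>
    refine (ih.trans (polyExec_pushAll r (List.replicate b true))).congr fun i => ?_
    simp [Nat.add_comm b]
  | MX p _ ih =>
    -- Horner's multiplication by the argument: for each unit in `r`, append as many units to `t` as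
    -- `a` has bits, then move the product back to `r`.
    refine ih.trans ⟨.seq (.loop r fun _ => expand a u t fun _ => [true]) (moveRev t r),
      (7 * Polynomial.X + 3) * p + 1 + (2 * (p * Polynomial.X) + 1), fun i => ?_⟩
    set n := (s i a).length with hn
    set k := p.eval n with hk
    have h₁ := Exec.loop (r := r) (k := fun _ => expand a u t fun _ => [true])
      (B := 7 * n + 2) (List.replicate k true)
      (fun q m => update (update (s i) r m) t (List.replicate (q.length * n) true))
      (fun q m => by simp [hrt]) (fun q x m _ => by
        refine ((exec_expand hau hat htu.symm (fun _ => [true]) _ ?_).mono ?_).congr ?_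
        · simp [hru.symm, htu.symm, hu]
        · simp [har, hat, ← hn]
        · funext v
          by_cases k₁ : v = t
          · subst k₁
            have h : ∀ l : List Bool, (l.flatMap fun _ => [true]) = List.replicate l.length true := by
              intro l
              induction l with
              | nil => rfl
              | cons b l ih => simp [ih, List.replicate_succ]
            simp [har, hat, hrt.symm, Nat.add_mul, h, hn, Nat.add_comm]
          · by_cases k₂ : v = r
            · subst k₂; simp [k₁]
            · simp [k₁, k₂])
    have e : update (update (s i) r (List.replicate k true)) t
        (List.replicate (([] : List Bool).length * n) true) =
        update (s i) r (List.replicate k true) := by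
      funext v
      by_cases k₁ : v = t
      · subst k₁; simp [hrt.symm, ht]
      · simp [k₁]
    rw [e] at h₁
    refine ((h₁.seq (exec_moveRev hrt.symm _)).mono ?_).congr ?_
    · have h2 : n ≤ size i := ha i
      have h3 : k ≤ p.eval (size i) := Polynomial.eval_mono_nat p h2
      simp only [Polynomial.eval_add, Polynomial.eval_mul, Polynomial.eval_one, Polynomial.eval_X,
        Polynomial.eval_ofNat, update_self, List.length_replicate]
      have h4 : (7 * n + 3) * k ≤ (7 * size i + 3) * p.eval (size i) := by gcongr
      have h5 : k * n ≤ p.eval (size i) * size i := by gcongr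
      linarith
    · funext v
      by_cases k₁ : v = r
      · subst k₁; simp [hrt, hk, hn]
      · by_cases k₂ : v = t
        · subst k₂; simp [k₁, ht]
        · simp [k₁, k₂]

end PolyExec

section Emits

variable {R : Type} [DecidableEq R] {I : Type} {size : I → ℕ} {o : R} {s : I → Store R}

/-- Append a list of instructions to the output. -/
def emit (o : R) (s : Store R) (ts : List Tok) : Store R := update s o ((encode ts).reverse ++ s o)

theorem emit_nil (o : R) (s : Store R) : emit o s [] = s := by
  simp [emit, encode]

theorem emit_emit (o : R) (s : Store R) (ts us : List Tok) :
    emit o (emit o s ts) us = emit o s (ts ++ us) := by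
  simp [emit, encode_append]

theorem emit_of_ne {r : R} (h : r ≠ o) (s : Store R) (ts : List Tok) : emit o s ts r = s r := by
  simp [emit, h]

/-- A fixed program appends the instructions `ts i` to the output in polynomial time. -/
def Emits (size : I → ℕ) (o : R) (s : I → Store R) (ts : I → List Tok) : Prop :=
  ∃ (c : Cmd R) (P : Polynomial ℕ), ∀ i us,
    Exec c (emit o (s i) us) (emit o (s i) (us ++ ts i)) (P.eval (size i))

/-- Composition works because `Emits` is uniform in the instructions already written. -/
theorem Emits.append {ts us : I → List Tok} (h : Emits size o s ts) (h' : Emits size o s us) :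
    Emits size o s fun i => ts i ++ us i := by
  obtain ⟨c, P, h⟩ := h
  obtain ⟨d, P', h'⟩ := h'
  refine ⟨.seq c d, P + P', fun i vs => ?_⟩
  rw [Polynomial.eval_add, ← List.append_assoc]
  exact (h i vs).seq (h' i _)

theorem Emits.const (ts : List Tok) : Emits size o s fun _ => ts := by
  refine ⟨pushAll o (encode ts), Polynomial.C ((encode ts).length + 1), fun i us => ?_⟩
  rw [Polynomial.eval_C, ← emit_emit]
  exact exec_pushAll o _ _

theorem Emits.flatMap {α : Type} (F : α → I → List Tok) (h : ∀ a, Emits size o s (F a))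
    (l : List α) : Emits size o s fun i => l.flatMap fun a => F a i := by
  induction l with
  | nil => exact .const []
  | cons a l ih => exact (h a).append ih

theorem Emits.register {a t : R} (hat : a ≠ t) (hao : a ≠ o) (hto : t ≠ o) (F : Bool → List Tok)
    (N : Polynomial ℕ) (hN : ∀ i, (s i a).length ≤ N.eval (size i)) (ht : ∀ i, s i t = []) :
    Emits size o s fun i => (s i a).flatMap F := by
  refine ⟨expand a t o fun b => encode (F b),
    Polynomial.C ((encode (F true)).length + (encode (F false)).length + 5) * N + 2, fun i us => ?_⟩
  rw [← emit_emit]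
  refine ((exec_expand hat hao hto _ _ (by rw [emit_of_ne hto, ht])).mono ?_).congr ?_
  · rw [emit_of_ne hao]
    simp only [Polynomial.eval_add, Polynomial.eval_mul, Polynomial.eval_C, Polynomial.eval_ofNat]
    have := hN i
    gcongr
  · rw [emit_of_ne hao, emit.eq_def o (emit o (s i) us)]
    simp [encode, List.flatMap_assoc]

theorem Emits.polyExec {ts : I → List Tok} (h : Emits size o s ts) :
    PolyExec size s fun i => emit o (s i) (ts i) := by
  obtain ⟨c, P, h⟩ := h
  exact ⟨c, P, fun i => by simpa [emit_nil] using h i []⟩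

end Emits

/-- Registers of the program that writes down the formulas of a machine. -/
inductive GReg
  | inp | tmp | aux | cp | cq | cg | cu | cs | out
  deriving DecidableEq

instance : Fintype GReg where
  elems := {.inp, .tmp, .aux, .cp, .cq, .cg, .cu, .cs, .out}
  complete r := by cases r <;> decide

/-- A store of the program that writes down the formulas of a machine. -/
def gst (x p q g u s o : List Bool) : Store GReg
  | .inp => x
  | .tmp => []
  | .aux => []
  | .cp => p
  | .cq => q
  | .cg => g
  | .cu => u
  | .cs => s
  | .out => o

theorem single_inp (x : List Bool) : single GReg.inp x = gst x [] [] [] [] [] [] := by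
  funext r; cases r <;> rfl

theorem single_out (o : List Bool) : single GReg.out o = gst [] [] [] [] [] [] o := by
  funext r; cases r <;> rfl

section gst

variable (x p q g u s o l : List Bool)

theorem update_gst_inp : update (gst x p q g u s o) .inp l = gst l p q g u s o := by
  funext r; cases r <;> rfl

theorem update_gst_cp : update (gst x p q g u s o) .cp l = gst x l q g u s o := by
  funext r; cases r <;> rfl

theorem update_gst_cq : update (gst x p q g u s o) .cq l = gst x p l g u s o := by
  funext r; cases r <;> rfl

theorem update_gst_cg : update (gst x p q g u s o) .cg l = gst x p q l u s o := by
  funext r; cases r <;> rfl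

theorem update_gst_cu : update (gst x p q g u s o) .cu l = gst x p q g l s o := by
  funext r; cases r <;> rfl

theorem update_gst_cs : update (gst x p q g u s o) .cs l = gst x p q g u l o := by
  funext r; cases r <;> rfl

theorem update_gst_out : update (gst x p q g u s o) .out l = gst x p q g u s l := by
  funext r; cases r <;> rfl

end gst

section Program

variable (p q g u : Polynomial ℕ)

/-- The counters of the program, in unary. -/
theorem polyExec_counters : PolyExec List.length (fun x : List Bool => single GReg.inp x)
    fun x => gst x (List.replicate (p.eval x.length) true) (List.replicate (q.eval x.length) true)
      (List.replicate (g.eval x.length) true) (List.replicate (u.eval x.length) true) [] [] := by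
  have h : ∀ (r : GReg) (N : Polynomial ℕ) (s : List Bool → Store GReg),
      GReg.inp ≠ r → r ≠ .tmp → r ≠ .aux → (∀ x, s x .inp = x) → (∀ x, s x r = []) →
      (∀ x, s x .tmp = []) → (∀ x, s x .aux = []) →
      PolyExec List.length s fun x => update (s x) r (List.replicate (N.eval x.length) true) := by
    intro r N s h₁ h₂ h₃ h₄ h₅ h₆ h₇
    refine (polyExec_polynomial h₁ (t := .tmp) (u := .aux) (by decide) (by decide) h₂ h₃ (by decide)
      N (fun i => by rw [h₄]) h₅ h₆ h₇).congr fun i => ?_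
    rw [h₄]
  simp only [single_inp]
  refine ((h .cp p _ (by decide) (by decide) (by decide) (fun _ => rfl) (fun _ => rfl)
    (fun _ => rfl) fun _ => rfl).congr fun x => update_gst_cp ..).trans ?_
  refine ((h .cq q _ (by decide) (by decide) (by decide) (fun _ => rfl) (fun _ => rfl)
    (fun _ => rfl) fun _ => rfl).congr fun x => update_gst_cq ..).trans ?_
  refine ((h .cg g _ (by decide) (by decide) (by decide) (fun _ => rfl) (fun _ => rfl)
    (fun _ => rfl) fun _ => rfl).congr fun x => update_gst_cg ..).trans ?_
  exact (h .cu u _ (by decide) (by decide) (by decide) (fun _ => rfl) (fun _ => rfl)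
    (fun _ => rfl) fun _ => rfl).congr fun x => update_gst_cu ..

theorem flatMap_replicate_const {α β : Type} (n : ℕ) (a : α) (l : List β) :
    ((List.replicate n a).flatMap fun _ => l) = (List.replicate n l).flatten := by
  rw [List.flatMap_def, List.map_replicate]

theorem flatten_replicate_star (n w : ℕ) :
    (List.replicate n (List.replicate w Tok.star)).flatten = List.replicate (n * w) Tok.star := by
  simp

/-- The instructions for the clauses of one position. -/
theorem emits_clausesAt (w : ℕ) (tp : List (Pat × Pat)) {I : Type} {size : I → ℕ}
    {s : I → Store GReg} (N : Polynomial ℕ) (hg : ∀ i, (s i .cg).length ≤ N.eval (size i))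
    (hs : ∀ i, (s i .cs).length ≤ N.eval (size i)) (ht : ∀ i, s i .tmp = []) :
    Emits size .out s fun i => clauseToks (clausesAt w (s i .cg).length tp (s i .cs).length) := by
  have h := Emits.flatMap (size := size) (o := GReg.out) (s := s) (fun (x : Pat × Pat) i =>
    ((s i .cs).flatMap fun _ => List.replicate w Tok.star) ++ (x.1.map litTok ++
      (((s i .cg).flatMap fun _ => List.replicate w Tok.star) ++ (x.2.map litTok ++ [.sep]))))
    (fun x => (Emits.register (t := .tmp) (by decide) (by decide) (by decide) _ N hs ht).append
      ((Emits.const _).append ((Emits.register (t := .tmp) (by decide) (by decide) (by decide) _ N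
        hg ht).append (Emits.const _)))) tp
  convert h using 2 with i
  simp only [clauseToks, clausesAt, List.flatMap_map]
  congr 1
  funext x
  have h₁ : ∀ l : List Bool, (l.flatMap fun _ => List.replicate w Tok.star) =
      List.replicate (l.length * w) Tok.star := by
    intro l
    rw [List.flatMap_def, List.map_const', flatten_replicate_star]
  rw [h₁, h₁]
  simp [litTok, List.append_assoc]

/-- Write down the clauses of all positions. -/
theorem polyExec_allClauses (w : ℕ) (tp : List (Pat × Pat)) (P Q G U O : List Bool → List Bool)
    (N : Polynomial ℕ) (hG : ∀ x, (G x).length ≤ N.eval x.length)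
    (hU : ∀ x, (U x).length ≤ N.eval x.length) :
    PolyExec List.length (fun x => gst x (P x) (Q x) (G x) (U x) [] (O x)) fun x =>
      gst x (P x) (Q x) (G x) [] (List.replicate (U x).length true)
        ((encode (clauseToks (allClauses w (G x).length (U x).length tp))).reverse ++ O x) := by
  -- The counters `cu` and `cs` change from round to round, so the stores are taken as part of the
  -- index; one program and one time bound then serve all rounds.
  obtain ⟨c, T, hc⟩ := emits_clausesAt w tp (I := {z : List Bool × Store GReg //
    (z.2 .cg).length ≤ N.eval z.1.length ∧ (z.2 .cs).length ≤ N.eval z.1.length ∧ z.2 .tmp = []})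
    (size := fun z => z.1.1.length) (s := fun z => z.1.2) N (fun z => z.2.1) (fun z => z.2.2.1)
    fun z => z.2.2.2
  refine ⟨.loop .cu fun _ => .seq c (.push .cs true), (T + 1 + 1) * N + 1, fun x => ?_⟩
  have h := Exec.loop (r := GReg.cu) (k := fun _ => .seq c (.push .cs true))
    (B := T.eval x.length + 1) (U x) (fun a l =>
      emit .out (gst x (P x) (Q x) (G x) l (List.replicate a.length true) (O x))
        (clauseToks (allClauses w (G x).length a.length tp)))
    (fun a l => emit_of_ne (by decide) _ _) (fun a b l hl => by
      have ha : a.length ≤ N.eval x.length := by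
        refine le_trans ?_ (hU x)
        rw [← hl]
        simp
      have h₁ := hc ⟨(x, gst x (P x) (Q x) (G x) l (List.replicate a.length true) (O x)), hG x,
        by simpa [gst] using ha, rfl⟩ (clauseToks (allClauses w (G x).length a.length tp))
      have e : update (emit .out (gst x (P x) (Q x) (G x) (b :: l) (List.replicate a.length true)
          (O x)) (clauseToks (allClauses w (G x).length a.length tp))) .cu l =
          emit .out (gst x (P x) (Q x) (G x) l (List.replicate a.length true) (O x))
            (clauseToks (allClauses w (G x).length a.length tp)) := by
        rw [emit, emit, update_gst_out, update_gst_cu, update_gst_out]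
        rfl
      rw [e]
      refine h₁.seq (Exec.push ?_)
      rw [emit_of_ne (by decide), emit, emit, update_gst_out, update_gst_cs, update_gst_out]
      simp [gst, allClauses, clauseToks, List.range_succ, List.replicate_succ])
  simp only [List.length_nil, List.replicate_zero] at h
  rw [show clauseToks (allClauses w (G x).length 0 tp) = [] from rfl, emit_nil] at h
  refine (h.mono ?_).congr (update_gst_out ..)
  simp only [Polynomial.eval_add, Polynomial.eval_mul, Polynomial.eval_one]
  have := hU x
  gcongr

end Program

section Machine

variable {K : Type} {Γ : K → Type} {Q : Type} [Fintype (Cell Q Γ)]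

/-- The demands that a formula of a machine makes, as instructions. -/
theorem map_reqTok_framePat (fin : Cell Q Γ) (x : List Bool) (p q V : ℕ) :
    (framePat (cellWidth Q Γ) V (initPats Q Γ x p q) (encCell fin)).map reqTok =
      (knownPat (.inl (none, none) : Cell Q Γ) ++ knownPat (.inl (none, none) : Cell Q Γ)).map
          reqTok ++
        (x.flatMap (fun b => (knownPat (rawBody (true, b) : Cell Q Γ) ++
            knownPat (rawBody (true, b) : Cell Q Γ)).map reqTok) ++
          ((knownPat (rawBody (true, false) : Cell Q Γ) ++
              knownPat (rawBody (true, true) : Cell Q Γ)).map reqTok ++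
            ((List.replicate p true).flatMap (fun _ => (guessPat Q Γ).map reqTok) ++
              ((List.replicate q true).flatMap
                  (fun _ => (knownPat (rawBody (false, false) : Cell Q Γ)).map reqTok) ++
                ((List.replicate V true).flatMap
                    (fun _ => List.replicate (cellWidth Q Γ) Tok.star) ++
                  ((encCell fin).map some).map reqTok))))) := by
  simp only [flatMap_replicate_const, flatten_replicate_star]
  simp [framePat, initPats, pairHead, reqTok, List.map_flatten, List.flatMap_def, List.map_map,
    Function.comp_def, List.append_assoc]
  induction x with
  | nil => rfl
  | cons b x ih => simp [ih]

/-- For a fixed machine the cell patterns and step clauses are constants. Only the numbers of their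
repetitions depend on `x`, and these are polynomials in its length, available as unary counters. -/
theorem progComputable_machineFormula [DecidableEq K]
    (δ : Q → (∀ k, Option (Γ k)) → Q × Act Γ) (q₀ : Q) (k₀ : K) (sym : Bool → Γ k₀) (fin : Cell Q Γ) (p q : Polynomial ℕ) :
    ProgComputable fun x =>
      machineFormula δ q₀ k₀ sym fin x (p.eval x.length) (q.eval x.length) := by
  set g : Polynomial ℕ := 2 * Polynomial.X + p + q with hg
  set u : Polynomial ℕ := (g + 3) * q + 1 with hu
  have hgx : ∀ n, g.eval n = 2 * n + p.eval n + q.eval n := fun n => by simp [hg]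
  have hux : ∀ n, u.eval n = (2 * n + p.eval n + q.eval n + 3) * q.eval n + 1 := fun n => by
    simp [hu, hgx]
  set S : List Bool → List Bool → List Bool → Store GReg := fun x l o =>
    gst x (List.replicate (p.eval x.length) true) (List.replicate (q.eval x.length) true)
      (List.replicate (g.eval x.length) true) l [] o with hS
  set D : List Bool → List Tok := fun x =>
    (framePat (cellWidth Q Γ) (u.eval x.length) (initPats Q Γ x (p.eval x.length)
      (q.eval x.length)) (encCell fin)).map reqTok ++ [.sep] with hD
  have h₁ : PolyExec List.length (fun x : List Bool => single GReg.inp x)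
      fun x => S x (List.replicate (u.eval x.length) true) [] := polyExec_counters p q g u
  have h₂ : Emits List.length GReg.out
      (fun x => S x (List.replicate (u.eval x.length) true) []) D := by
    simp only [hD, map_reqTok_framePat]
    have hreg : ∀ (r : GReg) (N : Polynomial ℕ) (F : Bool → List Tok), r ≠ .tmp → r ≠ .out →
        (∀ x, (S x (List.replicate (u.eval x.length) true) [] r).length ≤ N.eval x.length) →
        Emits List.length GReg.out (fun x => S x (List.replicate (u.eval x.length) true) [])
          fun x => (S x (List.replicate (u.eval x.length) true) [] r).flatMap F :=
      fun r N F h h' hN => .register h h' (by decide) F N hN fun _ => rfl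
    exact ((Emits.const _).append ((hreg .inp .X _ (by decide) (by decide) (by simp [hS, gst])).append
      ((Emits.const _).append ((hreg .cp p _ (by decide) (by decide) (by simp [hS, gst])).append
      ((hreg .cq q _ (by decide) (by decide) (by simp [hS, gst])).append
      ((hreg .cu u _ (by decide) (by decide) (by simp [hS, gst])).append
      (Emits.const _))))))).append (Emits.const _)
  -- The frame has a gap of `u` cells, but clauses are needed at `u + 1` positions, hence one more
  -- unit in `cu`.
  have h₃ := ((h₁.trans h₂.polyExec).congr fun x => update_gst_out ..).trans
    ((polyExec_pushAll .cu [true]).congr fun x => update_gst_cu ..)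
  have h₄ := h₃.trans (polyExec_allClauses (cellWidth Q Γ)
    (stepPats encCell (cellWidth Q Γ) (cellStep δ q₀ k₀ sym)) _ _ _
    (fun x => List.replicate (u.eval x.length + 1) true) _ (g + u + 1)
    (fun x => by simp; omega) (fun x => by simp))
  have h₅ := (h₄.trans ((polyExec_clear .inp .X fun x => by simp [gst]).congr
    fun x => update_gst_inp ..)).trans ((polyExec_clear .cp p fun x => by simp [gst]).congr
    fun x => update_gst_cp ..)
  have h₆ := (h₅.trans ((polyExec_clear .cq q fun x => by simp [gst]).congr
    fun x => update_gst_cq ..)).trans ((polyExec_clear .cg g fun x => by simp [gst]).congr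
    fun x => update_gst_cg ..)
  obtain ⟨c, T, h⟩ := h₆.trans ((polyExec_clear .cs (u + 1) fun x => by simp [gst]).congr
    fun x => update_gst_cs ..)
  refine ⟨GReg, inferInstance, inferInstance, c, .inp, .out, T, fun x => ?_⟩
  have e : machineFormula δ q₀ k₀ sym fin x (p.eval x.length) (q.eval x.length) =
      encode (D x ++ clauseToks (allClauses (cellWidth Q Γ) (g.eval x.length)
        (u.eval x.length + 1) (stepPats encCell (cellWidth Q Γ) (cellStep δ q₀ k₀ sym)))) := by
    simp only [machineFormula, formula, hD, hux, hgx, List.append_assoc, List.singleton_append]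
  obtain ⟨n, hn, hrun⟩ := h x
  refine ⟨n, hn, ?_⟩
  beta_reduce
  rw [e, single_out, encode_append, List.reverse_append]
  simpa [hS, gst] using hrun

end Machine

end RobustlyOften

/-! ### Collapse of the polynomial hierarchy on robust sets -/

namespace RobustlyOften

/-- For base at least `2`, coefficients and sums are absorbed into the exponent; this is why
`stretch` demands `2 ≤ n`. -/
theorem Polynomial.exists_eval_le_pow (p : Polynomial ℕ) : ∃ c : ℕ, ∀ n ≥ 2, p.eval n ≤ n ^ c := by
  induction p using Polynomial.induction_on' with
  | add p q hp hq =>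
    obtain ⟨a, ha⟩ := hp
    obtain ⟨b, hb⟩ := hq
    refine ⟨max a b + 1, fun n hn => ?_⟩
    have h₁ : n ^ a ≤ n ^ max a b := Nat.pow_le_pow_right (by omega) (le_max_left _ _)
    have h₂ : n ^ b ≤ n ^ max a b := Nat.pow_le_pow_right (by omega) (le_max_right _ _)
    have h₃ : n ^ max a b * 2 ≤ n ^ max a b * n := Nat.mul_le_mul_left _ hn
    have := ha n hn
    have := hb n hn
    rw [Polynomial.eval_add, pow_succ]
    omega
  | monomial m a =>
    refine ⟨a + m, fun n hn => ?_⟩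
    rw [Polynomial.eval_monomial, pow_add]
    exact Nat.mul_le_mul_right _ (Nat.lt_pow_self (by omega)).le

/-- The lengths `n ≥ 2` for which all of `n, …, n ^ c` belong to `S`. -/
def stretch (S : Set ℕ) (c : ℕ) : Set ℕ :=
  {n | 2 ≤ n ∧ ∀ j, n ≤ j → j ≤ n ^ c → j ∈ S}

theorem IsRobust.stretch {S : Set ℕ} (hS : IsRobust S) {c : ℕ} (hc : 0 < c) :
    IsRobust (stretch S c) := by
  refine ⟨fun n hn => lt_of_lt_of_le Nat.zero_lt_two hn.1, fun k hk => ?_⟩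
  -- A window up to `m ^ (k * c)` in `S` contains the window up to `n ^ c` above every `n ≤ m ^ k`.
  obtain ⟨m, hm, h⟩ := hS.2 (k * c) (Nat.mul_pos hk hc)
  refine ⟨m, hm, fun n hmn hn => ⟨hm.trans hmn, fun j hnj hj => h j (hmn.trans hnj) ?_⟩⟩
  rw [pow_mul]
  exact hj.trans (Nat.pow_le_pow_left hn c)

theorem stretch_mem {S : Set ℕ} {n c d : ℕ} (hn : n ∈ stretch S c) (hd : d ≤ c) {j : ℕ}
    (hnj : n ≤ j) (hj : j ≤ n ^ d) : j ∈ S :=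
  hn.2 j hnj (hj.trans (Nat.pow_le_pow_right (by have := hn.1; omega) hd))

theorem stretch_mem_stretch {S : Set ℕ} {n c d e : ℕ} (hn : n ∈ stretch S c) (hd : d * e ≤ c)
    {j : ℕ} (hnj : n ≤ j) (hj : j ≤ n ^ d) : j ∈ stretch S e := by
  refine ⟨hn.1.trans hnj, fun i hji hi => stretch_mem hn hd (hnj.trans hji) (hi.trans ?_)⟩
  rw [pow_mul]
  exact Nat.pow_le_pow_left hj e

theorem inOn_classP_iff {L : Language Bool} {S : Set ℕ} :
    InOn L classP S ↔ ∃ f : List Bool → Bool,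
      Nonempty (Turing.TM2ComputableInPolyTime (id : List Bool → List Bool)
        Computability.encodeBool f) ∧ ∀ x, x.length ∈ S → (x ∈ L ↔ f x = true) := by
  constructor
  · rintro ⟨L', ⟨f, hf, hL'⟩, h⟩
    refine ⟨f, hf, fun x hx => ?_⟩
    have := Set.ext_iff.1 (h _ hx) x
    simp only [slice, Set.mem_ofPred_eq, and_true] at this
    rw [this, hL']
  · rintro ⟨f, hf, h⟩
    refine ⟨{x | f x = true}, ⟨f, hf, fun _ => Iff.rfl⟩, fun n hn => Set.ext fun x => ?_⟩
    simp only [slice, Set.mem_ofPred_eq]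
    refine and_congr_left ?_
    rintro rfl
    exact h x hn

theorem length_pair (x y : List Bool) : (pair x y).length = 2 * x.length + 2 + y.length := by
  rw [← pairHead_append, List.length_append, length_pairHead]

/-- If satisfiability of bit clause formulas is in `P` on `S`, then so is every language of the
polynomial hierarchy on those lengths that have a large polynomial neighbourhood in `S`. -/
theorem inOn_stretch_of_mem_sigmaP {S : Set ℕ} (hS : InOn clauseSat classP S) (k : ℕ) :
    ∀ L ∈ sigmaP k, ∃ c > 0, InOn L classP (stretch S c) := by
  induction k with
  | zero => exact fun L hL => ⟨1, Nat.one_pos, L, hL, fun _ _ => rfl⟩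
  | succ k ih =>
    rintro L ⟨V, hV, p, hL⟩
    obtain ⟨c, -, hc⟩ := ih Vᶜ hV
    obtain ⟨f, ⟨M⟩, hf⟩ := inOn_classP_iff.1 hc
    obtain ⟨h, ⟨N⟩, hh⟩ := inOn_classP_iff.1 hS
    -- The answer sought is `false`, because `f` decides the complement of `V`.
    obtain ⟨K, _, Γ, Q, _, δ, q₀, k₀, sym, fin, q, hF⟩ := exists_machineFormula M false p
    have hcomp := progComputable_machineFormula δ q₀ k₀ sym fin p q
    set F : List Bool → List Bool := fun x =>
      machineFormula δ q₀ k₀ sym fin x (p.eval x.length) (q.eval x.length) with hFdef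
    obtain ⟨r, hr⟩ := hcomp.length_le
    obtain ⟨d, hd⟩ := Polynomial.exists_eval_le_pow (2 * Polynomial.X + 2 + p)
    obtain ⟨e, he⟩ := Polynomial.exists_eval_le_pow r
    -- The exponent `d * c` puts the lengths of all relevant pairs, at most `n ^ d`, into `stretch S
    -- c`; `e` puts the length of `F x` into `S`; the `1` ensures positivity.
    refine ⟨max (d * c) e + 1, Nat.succ_pos _, inOn_classP_iff.2 ⟨fun x => h (F x),
      hcomp.compose ⟨N⟩ fun _ => rfl, fun x hx => ?_⟩⟩
    have hlen : x.length ≤ (F x).length := by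
      refine le_trans ?_ (le_length_machineFormula δ q₀ k₀ sym fin x _ _)
      refine le_trans ?_ (Nat.le_mul_of_pos_right _ (Nat.succ_pos _))
      omega
    rw [hL, ← hh (F x) (stretch_mem hx ((le_max_right _ _).trans (Nat.le_succ _)) hlen
      ((hr x).trans (he _ hx.1))), hF]
    refine exists_congr fun y => and_congr_right fun hy => ?_
    have hpair := hf (pair x y) (stretch_mem_stretch hx ((le_max_left _ _).trans (Nat.le_succ _))
      (by rw [length_pair]; omega) (by
        refine le_trans ?_ (hd _ hx.1)
        simp only [Polynomial.eval_add, Polynomial.eval_mul, Polynomial.eval_X,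
          Polynomial.eval_ofNat, length_pair]
        omega))
    rw [← Bool.not_eq_true, ← hpair]
    exact not_not.symm

end RobustlyOften

/-- The same robust set serves every level; only the stretching exponent depends on `L`. -/
theorem mainTheorem4
    (hNP : RobustlyOften.classNP ⊆ RobustlyOften.ro RobustlyOften.classP) :
    RobustlyOften.classPH ⊆ RobustlyOften.ro RobustlyOften.classP := by
  obtain ⟨S, hS, hK⟩ := hNP RobustlyOften.clauseSat_mem_classNP
  intro L hL
  obtain ⟨k, hk⟩ := Set.mem_iUnion.1 hL
  obtain ⟨c, hc, h⟩ := RobustlyOften.inOn_stretch_of_mem_sigmaP hK k L hk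
  exact ⟨_, hS.stretch hc, h⟩
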